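/- **Conventions.** All rings are commutative. A *tdvr* is either an Artinian local ring whose maximal ideal is principal, or a discrete valuation ring. Let $A$ be a tdvr with maximal ideal $\mathfrak m$, and let $a\in\{1,2,\dots\}\cup\{\infty\}$ be the length of $A$ as an $A$-module. Let $R=A[x_1,\dots,x_n]$, let $L=Re_1\oplus\cdots\oplus Re_r$ be a free $R$-module of finite rank, and let $M\subseteq L$ be an $R$-submodule. Put $$\operatorname{gr}(A)=\bigoplus_{i\ge 0}\mathfrak m^i/\mathfrak m^{i+1},\qquad \operatorname{gr}(R)=\operatorname{gr}(A)[x_1,\dots,x_n],\qquad \operatorname{gr}(L)=\bigoplus_{i\ge0}\mathfrak m^iL/\mathfrak m^{i+1}L=\bigoplus_{X}\operatorname{gr}(A)\,X,$$ where $X$ runs over the set $\mathbb X_e$ of power products $x_1^{m_1}\cdots x_n^{m_n}e_l$ ($m_i\ge0$, $1\le l\le r$), and let $\operatorname{gr}(M)=\bigoplus_{i\ge0}(M\cap\mathfrak m^iL)/(M\cap\mathfrak m^{i+1}L)$, a graded $\operatorname{gr}(R)$-submodule of $\operatorname{gr}(L)$. For $X,Y\in\mathbb X_e$ write $X\mid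 Y$ if $Y=\boldsymbol xX$ for some monomial $\boldsymbol x=x_1^{m_1}\cdots x_n^{m_n}$. Fix a term order on $\mathbb X_e$, i.e. a total order such that $X<\boldsymbol xX$ for every monomial $\boldsymbol x\ne1$, and such that $X<Y$ implies $\boldsymbol xX<\boldsymbol xY$ for every monomial $\boldsymbol x$. For $0\ne f\in\operatorname{gr}(L)$ let $\operatorname{lp}(f)\in\mathbb X_e$ be the largest power product occurring in $f$, $\operatorname{lc}(f)\in\operatorname{gr}(A)$ its coefficient, and $\operatorname{lt}(f)=\operatorname{lc}(f)\operatorname{lp}(f)$; put $\operatorname{lt}(0)=0$, and let $\operatorname{lp}(0)$ be smaller than every power product. A *Gröbner basis* of $\operatorname{gr}(M)$ is a finite set $G=\{g_1,\dots,g_t\}$ of non-zero elements of $\operatorname{gr}(M)$ whose leading terms generate the same $\operatorname{gr}(R)$-submodule of $\operatorname{gr}(L)$ as the leading terms of all elements of $\operatorname{gr}(M)$ (so $G=\emptyset$ if $\operatorname{gr}(M)=0$). For a finite set $F=\{f_1,\dots,f_s\}$ of non-zero elements of $\operatorname{gr}(L)$, a *reduction step* $f\to h$ modulo $F$ is given by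 $a_i\in\operatorname{gr}(A)$ and monomials $\boldsymbol x_i$ with $h=f-\sum_i a_i\boldsymbol x_if_i$, with $\operatorname{lp}(f)=\boldsymbol x_i\operatorname{lp}(f_i)$ whenever $a_i\neq0$, and with $\operatorname{lt}(f)=\sum_ia_i\boldsymbol x_i\operatorname{lt}(f_i)$; $f$ *reduces strictly* to $h$ modulo $F$ if $h$ is obtained from $f$ by finitely many (at least one) reduction steps modulo $F$ and $\operatorname{lp}(h)<\operatorname{lp}(f)$. The Gröbner basis $G$ is *minimal* if no $g\in G$ can be strictly reduced modulo $G\smallsetminus\{g\}$. **Theorem.** Let $G=\{g_1,\dots,g_t\}$ be a Gröbner basis of $\operatorname{gr}(M)$; if $A$ is a discrete valuation ring, assume moreover that every $g_j$ is homogeneous, i.e. that all its coefficients lie in one and the same $\mathfrak m^i/\mathfrak m^{i+1}$. Write $c_j=\operatorname{lc}(g_j)$ and $X_j=\operatorname{lp}(g_j)$. For $X\in\mathbb X_e$ let $\mathfrak i_X$ be the ideal of $\operatorname{gr}(A)$ generated by the $c_j$ with $X_j\mid X$, and let $m_X\in\{0,1,2,\dots\}\cup\{\infty\}$ be the length of $\operatorname{gr}(A)/\mathfrak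 i_X$ as a $\operatorname{gr}(A)$-module. The following conditions are equivalent: (a) $L/M$ is flat over $A$; (b) $m_X\in\{0,a\}$ for every $X\in\mathbb X_e$; (c) for every $j$ there is a $j'$ such that $c_{j'}$ is a unit of $\operatorname{gr}(A)$ and $X_{j'}\mid X_j$. If $G$ is minimal, these conditions are also equivalent to: (c') $c_j$ is a unit of $\operatorname{gr}(A)$ for every $j$. -/

import Mathlib

/-! ### The associated graded ring of an ideal -/

/-- The graded piece `I ^ i / I ^ (i + 1)`. -/
abbrev GrPiece {A : Type*} [CommRing A] (I : Ideal A) (i : ℕ) : Type _ :=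
  ↥(I ^ i) ⧸ Submodule.comap (I ^ i).subtype (I ^ (i + 1))

namespace GrPiece

variable {A : Type*} [CommRing A] {I : Ideal A}

/-- The class in `I ^ i / I ^ (i + 1)` of an element of `I ^ i`. -/
def cls (I : Ideal A) (i : ℕ) (x : A) (hx : x ∈ I ^ i) : GrPiece I i :=
  Submodule.Quotient.mk ⟨x, hx⟩

theorem exists_cls {i : ℕ} (a : GrPiece I i) : ∃ x hx, a = cls I i x hx := by
  obtain ⟨⟨x, hx⟩, rfl⟩ := Submodule.Quotient.mk_surjective _ a
  exact ⟨x, hx, rfl⟩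

theorem cls_add {i : ℕ} {x y : A} (hx : x ∈ I ^ i) (hy : y ∈ I ^ i) :
    cls I i x hx + cls I i y hy = cls I i (x + y) (add_mem hx hy) := rfl

theorem cls_zero {i : ℕ} : cls I i 0 (zero_mem _) = 0 := rfl

theorem gradedMonoid_mk_cls {i j : ℕ} {x y : A} (hij : i = j) (hxy : x = y)
    (hx : x ∈ I ^ i) (hy : y ∈ I ^ j) :
    GradedMonoid.mk (A := GrPiece I) i (cls I i x hx) =
      GradedMonoid.mk (A := GrPiece I) j (cls I j y hy) := by
  subst hij; subst hxy; rfl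

theorem mul_mem_pow {i j : ℕ} {x y : A} (hx : x ∈ I ^ i) (hy : y ∈ I ^ j) :
    x * y ∈ I ^ (i + j) := by
  rw [pow_add]; exact Ideal.mul_mem_mul hx hy

/-- The product `I ^ i / I ^ (i + 1) × I ^ j / I ^ (j + 1) → I ^ (i + j) / I ^ (i + j + 1)`
induced by the multiplication of the ring. -/
def mul {i j : ℕ} (a : GrPiece I i) (b : GrPiece I j) : GrPiece I (i + j) :=
  Quotient.liftOn₂' a b (fun x y => cls I (i + j) (x.1 * y.1) (mul_mem_pow x.2 y.2)) (by
    intro x₁ y₁ x₂ y₂ hx hy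
    rw [Submodule.quotientRel_def] at hx hy
    refine (Submodule.Quotient.eq _).2 ?_
    have hx' : x₁.1 - x₂.1 ∈ I ^ (i + 1) := hx
    have hy' : y₁.1 - y₂.1 ∈ I ^ (j + 1) := hy
    change x₁.1 * y₁.1 - x₂.1 * y₂.1 ∈ I ^ (i + j + 1)
    have e : x₁.1 * y₁.1 - x₂.1 * y₂.1 = (x₁.1 - x₂.1) * y₁.1 + x₂.1 * (y₁.1 - y₂.1) := by ring
    rw [e]
    refine add_mem ?_ ?_
    · have := mul_mem_pow hx' y₁.2
      rwa [show i + 1 + j = i + j + 1 by ring] at this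
    · have := mul_mem_pow x₂.2 hy'
      rwa [← add_assoc] at this)

instance : GradedMonoid.GMul (GrPiece I) where
  mul := mul

theorem cls_mul {i j : ℕ} {x y : A} (hx : x ∈ I ^ i) (hy : y ∈ I ^ j) :
    GradedMonoid.GMul.mul (cls I i x hx) (cls I j y hy) = cls I (i + j) (x * y) (mul_mem_pow hx hy) := rfl

instance : GradedMonoid.GOne (GrPiece I) where
  one := cls I 0 1 (by simp)

instance gCommRing : DirectSum.GCommRing (GrPiece I) where
  mul_zero a := by
    obtain ⟨x, hx, rfl⟩ := exists_cls a
    rw [← cls_zero, cls_mul]; simp [cls_zero]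
  zero_mul b := by
    obtain ⟨x, hx, rfl⟩ := exists_cls b
    rw [← cls_zero, cls_mul]; simp [cls_zero]
  mul_add a b c := by
    obtain ⟨x, hx, rfl⟩ := exists_cls a
    obtain ⟨y, hy, rfl⟩ := exists_cls b
    obtain ⟨z, hz, rfl⟩ := exists_cls c
    simp only [cls_add, cls_mul, _root_.mul_add]
  add_mul a b c := by
    obtain ⟨x, hx, rfl⟩ := exists_cls a
    obtain ⟨y, hy, rfl⟩ := exists_cls b
    obtain ⟨z, hz, rfl⟩ := exists_cls c
    simp only [cls_add, cls_mul, _root_.add_mul]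
  one_mul := by
    rintro ⟨i, a⟩
    obtain ⟨x, hx, rfl⟩ := exists_cls a
    exact gradedMonoid_mk_cls (zero_add i) (_root_.one_mul x) _ _
  mul_one := by
    rintro ⟨i, a⟩
    obtain ⟨x, hx, rfl⟩ := exists_cls a
    exact gradedMonoid_mk_cls (add_zero i) (_root_.mul_one x) _ _
  mul_assoc := by
    rintro ⟨i, a⟩ ⟨j, b⟩ ⟨k, c⟩
    obtain ⟨x, hx, rfl⟩ := exists_cls a
    obtain ⟨y, hy, rfl⟩ := exists_cls b
    obtain ⟨z, hz, rfl⟩ := exists_cls c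
    exact gradedMonoid_mk_cls (add_assoc i j k) (_root_.mul_assoc x y z) _ _
  mul_comm := by
    rintro ⟨i, a⟩ ⟨j, b⟩
    obtain ⟨x, hx, rfl⟩ := exists_cls a
    obtain ⟨y, hy, rfl⟩ := exists_cls b
    exact gradedMonoid_mk_cls (add_comm i j) (_root_.mul_comm x y) _ _
  natCast k := cls I 0 k (by simp)
  natCast_zero := by simp [cls_zero]
  natCast_succ k := by simp only [Nat.cast_succ]; rfl
  intCast k := cls I 0 k (by simp)
  intCast_ofNat k := by simp
  intCast_negSucc_ofNat k := by
    simp only [Int.cast_negSucc]; rfl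

end GrPiece

/-- The associated graded ring `gr(A) = ⨁ i, 𝔪 ^ i / 𝔪 ^ (i + 1)` of a local ring `A` with maximal
ideal `𝔪`. -/
abbrev Gr (A : Type*) [CommRing A] [IsLocalRing A] : Type _ :=
  DirectSum ℕ (GrPiece (IsLocalRing.maximalIdeal A))

/-- A tdvr: an Artinian local ring with principal maximal ideal, or a discrete valuation ring. -/
def IsTDVR (A : Type*) [CommRing A] [IsLocalRing A] : Prop :=
  (IsArtinianRing A ∧ (IsLocalRing.maximalIdeal A).IsPrincipal) ∨
    ∃ _ : IsDomain A, IsDiscreteValuationRing A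

noncomputable section

/-! ### Power products, term orders, leading terms -/

/-- The free module `R e₁ ⊕ ⋯ ⊕ R eᵣ` over `R = B[x₁, …, xₙ]`. -/
abbrev FreeMod (n r : ℕ) (B : Type*) [CommRing B] : Type _ :=
  Fin r → MvPolynomial (Fin n) B

/-- The power product `x ^ exp • e_idx`. -/
structure PowerProduct (n r : ℕ) where
  exp : Fin n →₀ ℕ
  idx : Fin r

/-- The product of a power product by the monomial with exponent `s`. -/
def PowerProduct.shift {n r : ℕ} (s : Fin n →₀ ℕ) (X : PowerProduct n r) : PowerProduct n r :=
  ⟨s + X.exp, X.idx⟩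

/-- Divisibility of power products. -/
def PowerProduct.Divides {n r : ℕ} (X Y : PowerProduct n r) : Prop :=
  ∃ s : Fin n →₀ ℕ, Y = X.shift s

/-- The given total order on power products is a term order. -/
structure IsTermOrder (n r : ℕ) [LinearOrder (PowerProduct n r)] : Prop where
  lt_shift : ∀ (X : PowerProduct n r) (s : Fin n →₀ ℕ), s ≠ 0 → X < X.shift s
  shift_lt_shift : ∀ (X Y : PowerProduct n r) (s : Fin n →₀ ℕ), X < Y → X.shift s < Y.shift s

namespace FreeMod

variable {n r : ℕ} {B : Type*} [CommRing B]

/-- The coefficient of the power product `X` in `f`. -/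
def coeff (X : PowerProduct n r) (f : FreeMod n r B) : B :=
  (f X.idx).coeff X.exp

/-- The term `c X`. -/
def term (X : PowerProduct n r) (c : B) : FreeMod n r B :=
  Pi.single X.idx (MvPolynomial.monomial X.exp c)

variable [LinearOrder (PowerProduct n r)]

/-- The leading power product of `f`, that is, the largest power product with a non-zero
coefficient; it is `⊥` exactly if `f = 0`. -/
def lp (f : FreeMod n r B) : WithBot (PowerProduct n r) :=
  Finset.univ.sup fun l => (f l).support.sup fun s =>
    ((⟨s, l⟩ : PowerProduct n r) : WithBot (PowerProduct n r))

/-- The leading coefficient of `f` (zero if `f = 0`). -/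
def lc (f : FreeMod n r B) : B :=
  WithBot.recBotCoe 0 (fun X => coeff X f) (lp f)

/-- The leading term of `f` (zero if `f = 0`). -/
def lt (f : FreeMod n r B) : FreeMod n r B :=
  WithBot.recBotCoe 0 (fun X => term X (lc f)) (lp f)

/-- The submodule generated by the leading terms of the elements of `S`. -/
def Lt (S : Set (FreeMod n r B)) : Submodule (MvPolynomial (Fin n) B) (FreeMod n r B) :=
  Submodule.span _ (lt '' S)

/-- `G` is a Gröbner basis for `M`. -/
structure IsGroebnerBasis (M : Submodule (MvPolynomial (Fin n) B) (FreeMod n r B))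
    (G : Finset (FreeMod n r B)) : Prop where
  mem : ∀ g ∈ G, g ∈ M
  ne_zero : ∀ g ∈ G, g ≠ 0
  Lt_eq : Lt (G : Set (FreeMod n r B)) = Lt (M : Set (FreeMod n r B))

/-- One reduction step of `f` to `h` modulo `F`. -/
def ReducesStep (F : Finset (FreeMod n r B)) (f h : FreeMod n r B) : Prop :=
  ∃ (a : FreeMod n r B → B) (s : FreeMod n r B → (Fin n →₀ ℕ)),
    h = f - ∑ p ∈ F, MvPolynomial.monomial (s p) (a p) • p ∧
    (∀ p ∈ F, a p ≠ 0 → lp f = (lp p).map (PowerProduct.shift (s p))) ∧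
    lt f = ∑ p ∈ F, MvPolynomial.monomial (s p) (a p) • lt p

/-- `f` reduces to `h` modulo `F`, in finitely many steps. -/
def Reduces (F : Finset (FreeMod n r B)) (f h : FreeMod n r B) : Prop :=
  Relation.TransGen (ReducesStep F) f h

/-- `f` reduces strictly to `h` modulo `F`. -/
def ReducesStrictly (F : Finset (FreeMod n r B)) (f h : FreeMod n r B) : Prop :=
  Reduces F f h ∧ lp h < lp f

open Classical in
/-- No `g ∈ G` can be strictly reduced modulo `G ∖ {g}`: a Gröbner basis with this property is
minimal. -/
def IsMinimal (G : Finset (FreeMod n r B)) : Prop :=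
  ∀ g ∈ G, ¬ ∃ h, ReducesStrictly (G.erase g) g h

/-- The ideal generated by the leading coefficients of the elements of `G` whose leading power
product divides `X`. -/
def leadIdeal (G : Finset (FreeMod n r B)) (X : PowerProduct n r) : Ideal B :=
  Ideal.span {c | ∃ g ∈ G, ∃ Y : PowerProduct n r, lp g = Y ∧ Y.Divides X ∧ c = lc g}

/-- The invariant `m_X`: the length of the quotient of the coefficient ring by `leadIdeal G X`. -/
def mInv (G : Finset (FreeMod n r B)) (X : PowerProduct n r) : ℕ∞ :=
  Module.length B (B ⧸ leadIdeal G X)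

end FreeMod

/-! ### The associated graded module -/

variable {A : Type*} [CommRing A] [IsLocalRing A] {n r : ℕ}

/-- `F ∈ ⨁ gr(A) X` is homogeneous of degree `i`: all its coefficients lie in `gr^i(A)`. -/
def FreeMod.IsHomogeneousOfDegree (i : ℕ) (F : FreeMod n r (Gr A)) : Prop :=
  ∀ X, ∃ c : GrPiece (IsLocalRing.maximalIdeal A) i,
    FreeMod.coeff X F = DirectSum.of (GrPiece (IsLocalRing.maximalIdeal A)) i c

/-- Inside `gr(L) = ⨁ gr(A) X`, the piece `gr^i(M)`, the image of `M ∩ 𝔪 ^ i L` in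
`𝔪 ^ i L / 𝔪 ^ (i + 1) L = ⨁ gr^i(A) X`: the class of `f ∈ 𝔪 ^ i L` has the classes of the
coefficients of `f`, which lie in `𝔪 ^ i`, as its coefficients. -/
def grPart (M : Submodule (MvPolynomial (Fin n) A) (FreeMod n r A)) (i : ℕ) :
    Set (FreeMod n r (Gr A)) :=
  {F | ∃ f ∈ M, f ∈ (IsLocalRing.maximalIdeal A ^ i • ⊤ : Submodule A (FreeMod n r A)) ∧
    ∀ X, ∃ h : FreeMod.coeff X f ∈ IsLocalRing.maximalIdeal A ^ i,
      FreeMod.coeff X F = DirectSum.of (GrPiece (IsLocalRing.maximalIdeal A)) i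
        (GrPiece.cls _ i (FreeMod.coeff X f) h)}

/-- The `gr(R)`-submodule `gr(M) = ⨁ gr^i(M)` of `gr(L)`, where `gr(R) = gr(A)[x₁, …, xₙ]`. -/
def grSubmodule (M : Submodule (MvPolynomial (Fin n) A) (FreeMod n r A)) :
    Submodule (MvPolynomial (Fin n) (Gr A)) (FreeMod n r (Gr A)) :=
  Submodule.span _ (⋃ i, grPart M i)

end

/-! Let π generate 𝔪 and let t be its class in degree 1. A homogeneous element of gr(A) of degree i
is t^i times an element of gr⁰(A), the residue field. Flatness of L/M means M ∩ π^i L = π^i M for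
all i (`flat_quotient_iff`), so that the elements of gr(M) of degree i come from degree 0. Condition
(c), `HasUnitDivisors`, expresses this through leading terms, and the other conditions are compared
with it.

(a) ⇒ (c), `hasUnitDivisors_of_flat`: a component of g_j that does not vanish at X_j is the class of
some π^i f in M; flatness gives π^i f = π^i m with m in M, and the reduction of m modulo 𝔪 is an
element of gr(M) with unit leading coefficient at X_j. Hence 𝔦_{X_j} = (1), and some generator of
this ideal has a non-zero component of degree 0, hence is a unit.

(c) ⇒ (a): division by elements of M with unit leading coefficient modulo 𝔪 gives M ∩ π^i L ⊆ π^i M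
+ π^(i+1) L (`exists_smul_eq_add`), and Artin–Rees removes the error
(`exists_smul_eq_of_artinRees`).

(b) ⇔ (c): m_X = 0 means 𝔦_X = (1). Since gr(A) and A have the same length, 𝔦_X = 0 gives m_X = a,
and m_X = a is impossible once 𝔦_X contains some c_j. Over a discrete valuation ring this needs c_j
homogeneous. -/

namespace PowerProduct

/-! ### Divisibility and well-ordering of power products. -/

variable {n r : ℕ}

theorem Divides.refl (X : PowerProduct n r) : X.Divides X :=
  ⟨0, by simp [shift]⟩

theorem Divides.trans {X Y Z : PowerProduct n r} (h : X.Divides Y) (h' : Y.Divides Z) :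
    X.Divides Z := by
  obtain ⟨s, rfl⟩ := h
  obtain ⟨t, rfl⟩ := h'
  exact ⟨t + s, by simp [shift, add_assoc]⟩

variable [LinearOrder (PowerProduct n r)]

theorem Divides.le (hord : IsTermOrder n r) {X Y : PowerProduct n r} (h : X.Divides Y) :
    X ≤ Y := by
  obtain ⟨s, rfl⟩ := h
  by_cases hs : s = 0
  · simp [shift, hs]
  · exact (hord.lt_shift X s hs).le

/-- A term order is a well-order. -/
theorem wellFoundedLT (hord : IsTermOrder n r) : WellFoundedLT (PowerProduct n r) := by
  refine ⟨RelEmbedding.wellFounded_iff_isEmpty.2 ⟨fun e => ?_⟩⟩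
  -- Dickson's lemma: in a strictly decreasing sequence some term divides a later one, hence is at
  -- most that later one, a contradiction.
  have hq := (wellQuasiOrdered_le (α := Fin n →₀ ℕ)).prod
    (Finite.wellQuasiOrdered (α := Fin r) (· = ·))
  obtain ⟨i, j, hij, h₁, h₂⟩ := hq fun k => ((e k).exp, (e k).idx)
  have hlt : e j < e i := e.map_rel_iff.2 hij
  refine hlt.not_ge (Divides.le hord ⟨(e j).exp - (e i).exp, ?_⟩)
  have h₁' : (e i).exp ≤ (e j).exp := h₁
  have h₂' : (e i).idx = (e j).idx := h₂
  rw [shift, h₂', tsub_add_cancel_of_le h₁']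

end PowerProduct

/-! ### Coefficients, leading terms and reduction. -/

namespace FreeMod

variable {n r : ℕ} {B : Type*} [CommRing B]

theorem ext_coeff {f g : FreeMod n r B} (h : ∀ X, coeff X f = coeff X g) : f = g := by
  funext l
  ext s
  exact h ⟨s, l⟩

@[simp] theorem coeff_zero (X : PowerProduct n r) : coeff X (0 : FreeMod n r B) = 0 := by
  simp [coeff]

@[simp] theorem coeff_add (X : PowerProduct n r) (f g : FreeMod n r B) :
    coeff X (f + g) = coeff X f + coeff X g := by
  simp [coeff]

@[simp] theorem coeff_sub (X : PowerProduct n r) (f g : FreeMod n r B) :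
    coeff X (f - g) = coeff X f - coeff X g := by
  simp [coeff]

@[simp] theorem coeff_smul (X : PowerProduct n r) (b : B) (f : FreeMod n r B) :
    coeff X (b • f) = b * coeff X f := by
  simp [coeff]

@[simp] theorem coeff_monomial_smul_shift (s : Fin n →₀ ℕ) (b : B) (X : PowerProduct n r)
    (f : FreeMod n r B) :
    coeff (X.shift s) (MvPolynomial.monomial s b • f) = b * coeff X f := by
  simp [coeff, PowerProduct.shift, MvPolynomial.coeff_monomial_mul]

theorem coeff_monomial_smul_of_not_le {s : Fin n →₀ ℕ} (b : B) {X : PowerProduct n r}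
    (h : ¬ s ≤ X.exp) (f : FreeMod n r B) :
    coeff X (MvPolynomial.monomial s b • f) = 0 := by
  simp [coeff, MvPolynomial.coeff_monomial_mul', h]

/-- A power product is the multiple of another one by `s` as soon as `s` divides its exponent. -/
theorem _root_.PowerProduct.exists_eq_shift {s : Fin n →₀ ℕ} {X : PowerProduct n r}
    (h : s ≤ X.exp) : ∃ Y : PowerProduct n r, X = Y.shift s :=
  ⟨⟨X.exp - s, X.idx⟩, by cases X; simp_all [PowerProduct.shift]⟩

theorem C_smul_eq (b : B) (f : FreeMod n r B) :
    (MvPolynomial.C b : MvPolynomial (Fin n) B) • f = b • f := by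
  funext l
  simp [MvPolynomial.C_mul']

theorem coeff_term_self (X : PowerProduct n r) (c : B) : coeff X (term X c) = c := by
  simp [coeff, term]

theorem coeff_term_of_ne {X Y : PowerProduct n r} (h : X ≠ Y) (c : B) :
    coeff Y (term X c) = 0 := by
  classical
  obtain ⟨s, l⟩ := X
  obtain ⟨s', l'⟩ := Y
  by_cases hl : l' = l
  · subst hl
    have : s ≠ s' := fun hs => h (by rw [hs])
    simp [coeff, term, MvPolynomial.coeff_monomial, this]
  · simp [coeff, term, Pi.single_eq_of_ne hl]

theorem monomial_smul_term (s : Fin n →₀ ℕ) (b c : B) (X : PowerProduct n r) :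
    MvPolynomial.monomial s b • term X c = term (X.shift s) (b * c) := by
  rw [term, term, ← Pi.single_smul, smul_eq_mul, MvPolynomial.monomial_mul]
  rfl

variable [LinearOrder (PowerProduct n r)]

/-- The nested supremum defining `lp` is unfolded only here; everything later argues with
coefficients. -/
theorem lp_lt_iff {f : FreeMod n r B} {X : PowerProduct n r} :
    lp f < X ↔ ∀ Y, X ≤ Y → coeff Y f = 0 := by
  rw [lp, Finset.sup_lt_iff (WithBot.bot_lt_coe X)]
  constructor
  · intro h Y hXY
    by_contra hne
    have h₁ := (Finset.sup_lt_iff (WithBot.bot_lt_coe X)).1 (h Y.idx (Finset.mem_univ _)) Y.exp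
      (MvPolynomial.mem_support_iff.2 hne)
    exact (WithBot.coe_lt_coe.1 h₁).not_ge hXY
  · intro h l _
    rw [Finset.sup_lt_iff (WithBot.bot_lt_coe X)]
    intro s hs
    rw [WithBot.coe_lt_coe]
    by_contra hle
    exact MvPolynomial.mem_support_iff.1 hs (h ⟨s, l⟩ (not_lt.1 hle))

theorem le_lp {f : FreeMod n r B} {X : PowerProduct n r} (h : coeff X f ≠ 0) :
    (X : WithBot (PowerProduct n r)) ≤ lp f := by
  by_contra hlt
  exact h (lp_lt_iff.1 (not_le.1 hlt) X le_rfl)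

theorem coeff_eq_zero_of_lp_lt {f : FreeMod n r B} {X : PowerProduct n r} (h : lp f < X) :
    coeff X f = 0 :=
  lp_lt_iff.1 h X le_rfl

theorem coeff_ne_zero_of_lp_eq {f : FreeMod n r B} {X : PowerProduct n r} (h : lp f = X) :
    coeff X f ≠ 0 := by
  intro h0
  refine lt_irrefl (X : WithBot (PowerProduct n r)) ?_
  nth_rw 1 [← h]
  refine lp_lt_iff.2 fun Y hY => ?_
  rcases hY.eq_or_lt with rfl | hlt
  · exact h0
  · exact coeff_eq_zero_of_lp_lt (by rw [h]; exact_mod_cast hlt)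

theorem lp_eq_iff {f : FreeMod n r B} {X : PowerProduct n r} :
    lp f = X ↔ coeff X f ≠ 0 ∧ ∀ Y, X < Y → coeff Y f = 0 := by
  refine ⟨fun h => ⟨coeff_ne_zero_of_lp_eq h, fun Y hY => coeff_eq_zero_of_lp_lt ?_⟩,
    fun ⟨h, h'⟩ => ?_⟩
  · rw [h]; exact_mod_cast hY
  · refine le_antisymm ?_ (le_lp h)
    by_contra hlt
    rw [not_le] at hlt
    obtain ⟨Y, hY⟩ := WithBot.ne_bot_iff_exists.1 (ne_bot_of_gt hlt)
    rw [← hY, WithBot.coe_lt_coe] at hlt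
    exact coeff_ne_zero_of_lp_eq hY.symm (h' Y hlt)

theorem exists_lp_eq {f : FreeMod n r B} (h : f ≠ 0) :
    ∃ X : PowerProduct n r, lp f = X := by
  have : ∃ X, coeff X f ≠ 0 := by
    by_contra! h'
    exact h (ext_coeff fun X => by rw [h' X, coeff_zero])
  obtain ⟨X, hX⟩ := this
  obtain ⟨Y, hY⟩ := WithBot.ne_bot_iff_exists.1
    (ne_bot_of_le_ne_bot (WithBot.coe_ne_bot (a := X)) (le_lp hX))
  exact ⟨Y, hY.symm⟩

theorem lc_of_lp_eq {f : FreeMod n r B} {X : PowerProduct n r} (h : lp f = X) :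
    lc f = coeff X f := by
  rw [lc, h]; rfl

theorem lt_of_lp_eq {f : FreeMod n r B} {X : PowerProduct n r} (h : lp f = X) :
    lt f = term X (lc f) := by
  rw [lt, h]; rfl

theorem lc_ne_zero {f : FreeMod n r B} (h : f ≠ 0) : lc f ≠ 0 := by
  obtain ⟨X, hX⟩ := exists_lp_eq h
  rw [lc_of_lp_eq hX]
  exact coeff_ne_zero_of_lp_eq hX

theorem lc_mem_leadIdeal {G : Finset (FreeMod n r B)} {g : FreeMod n r B} (hg : g ∈ G)
    {X Y : PowerProduct n r} (hY : lp g = Y) (hXY : Y.Divides X) : lc g ∈ leadIdeal G X :=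
  Ideal.subset_span ⟨g, hg, Y, hY, hXY, rfl⟩

theorem leadIdeal_mono (G : Finset (FreeMod n r B)) {X Y : PowerProduct n r} (h : X.Divides Y) :
    leadIdeal G X ≤ leadIdeal G Y := by
  refine Ideal.span_mono ?_
  rintro c ⟨g, hg, Z, hZ, hZX, rfl⟩
  exact ⟨g, hg, Z, hZ, hZX.trans h, rfl⟩

/-- Since the ideals grow along divisibility, the elements whose coefficient at each X lies in
`leadIdeal G X` form a submodule; it contains the leading terms of G. -/
theorem coeff_mem_leadIdeal {G : Finset (FreeMod n r B)} (h0 : ∀ g ∈ G, g ≠ 0)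
    {F : FreeMod n r B} (hF : F ∈ Lt (G : Set (FreeMod n r B))) (X : PowerProduct n r) :
    coeff X F ∈ leadIdeal G X := by
  induction hF using Submodule.span_induction generalizing X with
  | mem F hF =>
    obtain ⟨g, hg, rfl⟩ := hF
    obtain ⟨Y, hY⟩ := exists_lp_eq (h0 g hg)
    rw [lt_of_lp_eq hY]
    by_cases hXY : Y = X
    · rw [hXY, coeff_term_self]
      exact lc_mem_leadIdeal hg hY (hXY ▸ PowerProduct.Divides.refl Y)
    · rw [coeff_term_of_ne hXY]
      exact zero_mem _
  | zero => simp
  | add F F' _ _ h h' => rw [coeff_add]; exact add_mem (h X) (h' X)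
  | smul p F _ h =>
    induction p using MvPolynomial.induction_on' generalizing X with
    | monomial s b =>
      by_cases hs : s ≤ X.exp
      · obtain ⟨Y, rfl⟩ := PowerProduct.exists_eq_shift hs
        rw [coeff_monomial_smul_shift]
        exact Ideal.mul_mem_left _ _ (leadIdeal_mono G ⟨s, rfl⟩ (h Y))
      · rw [coeff_monomial_smul_of_not_le b hs]
        exact zero_mem _
    | add p q hp hq => rw [add_smul, coeff_add]; exact add_mem (hp X) (hq X)

/-- The leading coefficients of the elements of a module lie in the ideals given by a Gröbner
basis. -/
theorem IsGroebnerBasis.coeff_mem_leadIdeal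
    {M : Submodule (MvPolynomial (Fin n) B) (FreeMod n r B)} {G : Finset (FreeMod n r B)}
    (hG : IsGroebnerBasis M G) {F : FreeMod n r B} (hF : F ∈ M) {X : PowerProduct n r}
    (hX : lp F = X) : coeff X F ∈ leadIdeal G X := by
  have h : lt F ∈ Lt (G : Set (FreeMod n r B)) := by
    rw [hG.Lt_eq]
    exact Submodule.subset_span ⟨F, hF, rfl⟩
  have := FreeMod.coeff_mem_leadIdeal hG.ne_zero h X
  rwa [lt_of_lp_eq hX, coeff_term_self, lc_of_lp_eq hX] at this

/-- If the leading coefficient of `p` is a unit and the leading power product of `p` divides that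
of `f`, then `f` can be strictly reduced modulo any set that contains `p`. -/
theorem exists_reducesStrictly (hord : IsTermOrder n r) {F : Finset (FreeMod n r B)}
    {f p : FreeMod n r B} (hp : p ∈ F) {X Y : PowerProduct n r} (hf : lp f = X) (hpY : lp p = Y)
    (hYX : Y.Divides X) (hu : IsUnit (lc p)) : ∃ h, ReducesStrictly F f h := by
  classical
  obtain ⟨s, rfl⟩ := hYX
  obtain ⟨v, hv⟩ := hu.exists_left_inv
  -- The reduction uses p alone, with coefficient `lc f * v`, where v is the inverse of `lc p`.
  have hsum : ∀ q : FreeMod n r B → FreeMod n r B, ∑ p' ∈ F,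
      MvPolynomial.monomial s (if p' = p then lc f * v else 0) • q p' =
        MvPolynomial.monomial s (lc f * v) • q p := by
    intro q
    rw [Finset.sum_eq_single_of_mem p hp]
    · rw [if_pos rfl]
    · intro p' _ hne
      rw [if_neg hne, map_zero, zero_smul]
  refine ⟨f - MvPolynomial.monomial s (lc f * v) • p, Relation.TransGen.single
    ⟨fun p' => if p' = p then lc f * v else 0, fun _ => s, ?_, ?_, ?_⟩, ?_⟩
  · rw [hsum fun p => p]
  · intro p' _ hne
    have : p' = p := by
      by_contra h
      exact hne (if_neg h)
    rw [this, hf, hpY]; rfl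
  · rw [hsum lt, lt_of_lp_eq hf, lt_of_lp_eq hpY, monomial_smul_term, mul_assoc, hv, mul_one]
  · rw [hf]
    refine lp_lt_iff.2 fun Z hZ => ?_
    rw [coeff_sub]
    rcases hZ.eq_or_lt with rfl | hlt
    · rw [coeff_monomial_smul_shift, ← lc_of_lp_eq hpY, mul_assoc, hv, mul_one,
        ← lc_of_lp_eq hf, sub_self]
    · rw [(lp_eq_iff.1 hf).2 Z hlt, zero_sub, neg_eq_zero]
      by_cases hs : s ≤ Z.exp
      · obtain ⟨W, rfl⟩ := PowerProduct.exists_eq_shift hs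
        rw [coeff_monomial_smul_shift, (lp_eq_iff.1 hpY).2 W, mul_zero]
        -- W ≤ Y would give sW ≤ sY, against sY < sW.
        by_contra hle
        rcases (not_lt.1 hle).eq_or_lt with rfl | h
        · exact lt_irrefl _ hlt
        · exact lt_asymm hlt (hord.shift_lt_shift _ _ s h)
      · exact coeff_monomial_smul_of_not_le _ hs _

end FreeMod

/-! ### Flatness of quotients over principal ideal rings. -/

open TensorProduct in
/-- If `p : L → N` is surjective with `L` flat and every ideal of `A` is principal, then `N` is
flat exactly if `ker p ∩ x L = x ker p` for every `x`. -/
theorem Module.Flat.iff_forall_smul_mem_ker {A L N : Type*} [CommRing A]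
    [IsPrincipalIdealRing A] [AddCommGroup L] [Module A L] [AddCommGroup N] [Module A N]
    [Module.Flat A L] (p : L →ₗ[A] N) (hp : Function.Surjective p) :
    Module.Flat A N ↔ ∀ (x : A) (l : L), p (x • l) = 0 → ∃ m, p m = 0 ∧ x • l = x • m := by
  constructor
  · intro _ x l hl
    let I : Ideal A := Ideal.span {x}
    have hx : x ∈ I := Ideal.mem_span_singleton_self x
    have hinj := Module.Flat.iff_lift_lsmul_comp_subtype_injective.1 ‹Module.Flat A N›
      (I := I) ⟨{x}, by simp [I]⟩
    have h0 : (⟨x, hx⟩ : I) ⊗ₜ[A] p l = 0 := by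
      apply hinj
      simpa using hl
    have hex := _root_.lTensor_exact I (LinearMap.exact_subtype_ker_map p) hp
    -- By right exactness x ⊗ l, which dies in I ⊗ N, comes from I ⊗ ker p. As I is principal, its
    -- preimage is a pure tensor x ⊗ m.
    obtain ⟨z, hz⟩ := (hex ((⟨x, hx⟩ : I) ⊗ₜ[A] l)).1 (by rw [LinearMap.lTensor_tmul, h0])
    have hz' : ∃ m : LinearMap.ker p, z = (⟨x, hx⟩ : I) ⊗ₜ[A] m := by
      clear hz
      induction z with
      | zero => exact ⟨0, by simp⟩
      | tmul y m =>
        obtain ⟨y, hy⟩ := y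
        obtain ⟨c, rfl⟩ := Ideal.mem_span_singleton'.1 hy
        refine ⟨c • m, ?_⟩
        rw [← TensorProduct.smul_tmul]
        rfl
      | add a b ha hb =>
        obtain ⟨m, rfl⟩ := ha
        obtain ⟨m', rfl⟩ := hb
        exact ⟨m + m', (TensorProduct.tmul_add _ _ _).symm⟩
    obtain ⟨m, rfl⟩ := hz'
    refine ⟨m, m.2, ?_⟩
    have := congrArg (TensorProduct.lift ((LinearMap.lsmul A L).comp I.subtype)) hz
    simpa using this.symm
  · intro h
    rw [Module.Flat.iff_lift_lsmul_comp_subtype_injective]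
    intro I _
    obtain ⟨x, rfl⟩ := IsPrincipalIdealRing.principal I
    have hx : x ∈ Submodule.span A {x} := Submodule.mem_span_singleton_self x
    rw [injective_iff_map_eq_zero]
    intro z hz
    have hz' : ∃ y : N, z = (⟨x, hx⟩ : Submodule.span A {x}) ⊗ₜ[A] y := by
      clear hz
      induction z with
      | zero => exact ⟨0, by simp⟩
      | tmul y m =>
        obtain ⟨y, hy⟩ := y
        obtain ⟨c, rfl⟩ := Submodule.mem_span_singleton.1 hy
        refine ⟨c • m, ?_⟩
        rw [← TensorProduct.smul_tmul]
        rfl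
      | add a b ha hb =>
        obtain ⟨m, rfl⟩ := ha
        obtain ⟨m', rfl⟩ := hb
        exact ⟨m + m', (TensorProduct.tmul_add _ _ _).symm⟩
    obtain ⟨y, rfl⟩ := hz'
    obtain ⟨l, rfl⟩ := hp y
    obtain ⟨m, hm, hlm⟩ := h x l (by simpa using hz)
    have hinj := Module.Flat.iff_lift_lsmul_comp_subtype_injective.1 ‹Module.Flat A L›
      (I := Submodule.span A {x}) ⟨{x}, by simp⟩
    -- Flatness of L turns x(l − m) = 0 into the vanishing of this tensor, whose image in I ⊗ N is x
    -- ⊗ p l because p m = 0.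
    have h0 : (⟨x, hx⟩ : Submodule.span A {x}) ⊗ₜ[A] (l - m) = 0 := by
      apply hinj
      simp [smul_sub, hlm]
    have := congrArg (LinearMap.lTensor (Submodule.span A {x}) p) h0
    simpa [hm] using this

/-! ### Local rings with principal maximal ideal, and lengths. -/

/-- In a Noetherian local ring with principal maximal ideal `(π)`, every element is zero or the
product of a unit and a power of `π`. -/
theorem IsLocalRing.eq_zero_or_eq_unit_mul_pow {A : Type*} [CommRing A] [IsLocalRing A]
    [IsNoetherianRing A] {π : A} (hπ : maximalIdeal A = Ideal.span {π}) (x : A) :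
    x = 0 ∨ ∃ (u : A) (i : ℕ), IsUnit u ∧ x = u * π ^ i := by
  classical
  by_cases hx : ∀ i, x ∈ maximalIdeal A ^ i
  · left
    -- Krull's intersection theorem.
    have := (Submodule.mem_iInf fun i : ℕ => maximalIdeal A ^ i).2 hx
    rwa [Ideal.iInf_pow_eq_bot_of_isLocalRing _ (maximalIdeal.isMaximal A).ne_top] at this
  · right
    push Not at hx
    obtain ⟨i, hi⟩ : ∃ i, Nat.find hx = i + 1 :=
      Nat.exists_eq_succ_of_ne_zero fun h0 => by
        have := Nat.find_spec hx
        rw [h0] at this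
        simp at this
    have h1 : x ∈ maximalIdeal A ^ i := by
      by_contra h
      have := Nat.find_min' hx h
      omega
    have h2 : x ∉ maximalIdeal A ^ (i + 1) := hi ▸ Nat.find_spec hx
    rw [hπ, Ideal.span_singleton_pow] at h1 h2
    obtain ⟨u, rfl⟩ := Ideal.mem_span_singleton'.1 h1
    refine ⟨u, i, ?_, rfl⟩
    by_contra hu
    have hu : u ∈ maximalIdeal A := hu
    rw [hπ] at hu
    obtain ⟨v, rfl⟩ := Ideal.mem_span_singleton'.1 hu
    exact h2 (Ideal.mem_span_singleton'.2 ⟨v, by ring⟩)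

/-- With every non-zero element a unit times a power of π, an ideal is either zero or generated by
the lowest power of π in it. -/
theorem IsLocalRing.isPrincipalIdealRing_of_maximalIdeal_eq {A : Type*} [CommRing A]
    [IsLocalRing A] [IsNoetherianRing A] {π : A} (hπ : maximalIdeal A = Ideal.span {π}) :
    IsPrincipalIdealRing A := by
  classical
  refine ⟨fun I => ?_⟩
  by_cases h : ∃ i, π ^ i ∈ I
  · refine ⟨⟨π ^ Nat.find h, le_antisymm (fun x hx => ?_) ?_⟩⟩
    · rcases eq_zero_or_eq_unit_mul_pow hπ x with rfl | ⟨u, i, hu, rfl⟩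
      · exact zero_mem _
      · have : π ^ i ∈ I := (Ideal.unit_mul_mem_iff_mem I hu).1 hx
        exact Ideal.mul_mem_left _ _
          (Ideal.mem_span_singleton.2 (pow_dvd_pow π (Nat.find_min' h this)))
    · exact (Submodule.span_singleton_le_iff_mem _ _).2 (Nat.find_spec h)
  · refine ⟨⟨0, le_antisymm (fun x hx => ?_) (by simp)⟩⟩
    rcases eq_zero_or_eq_unit_mul_pow hπ x with rfl | ⟨u, i, hu, rfl⟩
    · exact zero_mem _
    · exact absurd ⟨i, (Ideal.unit_mul_mem_iff_mem I hu).1 hx⟩ h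

/-- The length of `B / (t ^ (i + 1))` when `(t)` is a maximal ideal. -/
theorem length_quotient_span_pow_succ {B : Type*} [CommRing B] {t : B}
    (ht : (Ideal.span {t}).IsMaximal) (i : ℕ) [Decidable (t ^ (i + 1) ∣ t ^ i)] :
    Module.length B (B ⧸ Ideal.span {t ^ (i + 1)}) =
      Module.length B (B ⧸ Ideal.span {t ^ i}) + if t ^ (i + 1) ∣ t ^ i then 0 else 1 := by
  split_ifs with h
  · have : Ideal.span {t ^ (i + 1)} = Ideal.span {t ^ i} :=
      le_antisymm (Ideal.span_singleton_le_span_singleton.2 (pow_dvd_pow t i.le_succ))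
        (Ideal.span_singleton_le_span_singleton.2 h)
    rw [this, add_zero]
  · have hsimple : IsSimpleModule B (B ⧸ Ideal.span {t}) :=
      isSimpleModule_iff_isCoatom.2 ht.out
    -- Length is additive on 0 → B/(t) → B/(t^(i+1)) → B/(t^i) → 0, the first map being
    -- multiplication by t^i. It is injective because B/(t) is simple and the map is non-zero.
    let f : (B ⧸ Ideal.span {t}) →ₗ[B] B ⧸ Ideal.span {t ^ (i + 1)} :=
      Submodule.mapQ _ _ (LinearMap.lsmul B B (t ^ i)) (by
        intro x hx
        obtain ⟨y, rfl⟩ := Ideal.mem_span_singleton'.1 hx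
        exact Ideal.mem_span_singleton'.2 ⟨y, by simp; ring⟩)
    let g : (B ⧸ Ideal.span {t ^ (i + 1)}) →ₗ[B] B ⧸ Ideal.span {t ^ i} :=
      Submodule.factor (Ideal.span_singleton_le_span_singleton.2 (pow_dvd_pow t i.le_succ))
    have hf : Function.Injective f := by
      refine (LinearMap.injective_or_eq_zero f).resolve_right fun h0 => h ?_
      have h1 := LinearMap.congr_fun h0 (Submodule.Quotient.mk 1)
      rw [LinearMap.zero_apply, Submodule.mapQ_apply, Submodule.Quotient.mk_eq_zero] at h1
      simpa [Ideal.mem_span_singleton] using h1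
    have hg : Function.Surjective g := Submodule.factor_surjective _
    have hex : Function.Exact f g := by
      intro y
      obtain ⟨y, rfl⟩ := Submodule.Quotient.mk_surjective _ y
      constructor
      · intro hy
        have hy' : y ∈ Ideal.span {t ^ i} := (Submodule.Quotient.mk_eq_zero _).1 hy
        obtain ⟨z, rfl⟩ := Ideal.mem_span_singleton'.1 hy'
        refine ⟨Submodule.Quotient.mk z, ?_⟩
        rw [Submodule.mapQ_apply]
        simp [mul_comm]
      · rintro ⟨z, hz⟩
        obtain ⟨z, rfl⟩ := Submodule.Quotient.mk_surjective _ z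
        rw [← hz, Submodule.mapQ_apply]
        refine (Submodule.Quotient.mk_eq_zero _).2 ?_
        exact Ideal.mem_span_singleton'.2 ⟨z, by simp [mul_comm]⟩
    rw [Module.length_eq_add_of_exact f g hf hg hex, Module.length_eq_one, add_comm]

theorem length_quotient_span_pow_ne_top {B : Type*} [CommRing B] {t : B}
    (ht : (Ideal.span {t}).IsMaximal) (i : ℕ) :
    Module.length B (B ⧸ Ideal.span {t ^ i}) ≠ ⊤ := by
  classical
  induction i with
  | zero =>
    have : Subsingleton (B ⧸ Ideal.span {t ^ 0}) :=
      Submodule.Quotient.subsingleton_iff.2 (by simp)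
    rw [Module.length_eq_zero]
    simp
  | succ i ih =>
    rw [length_quotient_span_pow_succ ht]
    split_ifs <;> simp [ih]

/-- The lengths of `B / (t ^ i)` are determined by the set of `i` with `t ^ (i + 1) ∣ t ^ i`. -/
theorem length_quotient_span_pow_eq {B B' : Type*} [CommRing B] [CommRing B'] {t : B} {t' : B'}
    (ht : (Ideal.span {t}).IsMaximal) (ht' : (Ideal.span {t'}).IsMaximal)
    (h : ∀ i, t ^ (i + 1) ∣ t ^ i ↔ t' ^ (i + 1) ∣ t' ^ i) (i : ℕ) :
    Module.length B (B ⧸ Ideal.span {t ^ i}) = Module.length B' (B' ⧸ Ideal.span {t' ^ i}) := by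
  classical
  induction i with
  | zero =>
    have : Subsingleton (B ⧸ Ideal.span {t ^ 0}) :=
      Submodule.Quotient.subsingleton_iff.2 (by simp)
    have : Subsingleton (B' ⧸ Ideal.span {t' ^ 0}) :=
      Submodule.Quotient.subsingleton_iff.2 (by simp)
    rw [Module.length_eq_zero, Module.length_eq_zero]
  | succ i ih =>
    rw [length_quotient_span_pow_succ ht, length_quotient_span_pow_succ ht', ih]
    simp only [h i]

open IsLocalRing

/-! ### The structure of gr(A): degrees, units, uniformizer, length. -/

namespace Gr

variable {A : Type*} [CommRing A] [IsLocalRing A]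

/-- The ring structure of `gr(A)`, as a shortcut for instance search. -/
noncomputable local instance instCommRing : CommRing (Gr A) := inferInstance

/-- The class in `𝔪 ^ i / 𝔪 ^ (i + 1)` of an element of `𝔪 ^ i`, as an element of `gr(A)`. -/
noncomputable def initial (i : ℕ) (x : A) (hx : x ∈ maximalIdeal A ^ i) : Gr A :=
  DirectSum.of (GrPiece (maximalIdeal A)) i (GrPiece.cls _ i x hx)

theorem initial_congr {i j : ℕ} {x y : A} (hij : i = j) (hxy : x = y)
    (hx : x ∈ maximalIdeal A ^ i) : initial i x hx = initial j y (hij ▸ hxy ▸ hx) := by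
  subst hij; subst hxy; rfl

theorem initial_mul {i j : ℕ} {x y : A} (hx : x ∈ maximalIdeal A ^ i)
    (hy : y ∈ maximalIdeal A ^ j) :
    initial i x hx * initial j y hy = initial (i + j) (x * y) (GrPiece.mul_mem_pow hx hy) :=
  DirectSum.of_mul_of _ _

theorem initial_add {i : ℕ} {x y : A} (hx : x ∈ maximalIdeal A ^ i)
    (hy : y ∈ maximalIdeal A ^ i) :
    initial i x hx + initial i y hy = initial i (x + y) (add_mem hx hy) :=
  (map_add (DirectSum.of (GrPiece (maximalIdeal A)) i) _ _).symm

theorem initial_zero (i : ℕ) : initial i (0 : A) (zero_mem _) = 0 :=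
  map_zero (DirectSum.of (GrPiece (maximalIdeal A)) i)

theorem _root_.GrPiece.cls_eq_zero_iff {A : Type*} [CommRing A] {I : Ideal A} {i : ℕ} {x : A} (hx : x ∈ I ^ i) :
    GrPiece.cls I i x hx = 0 ↔ x ∈ I ^ (i + 1) :=
  Submodule.Quotient.mk_eq_zero _

theorem initial_eq_zero_iff {i : ℕ} {x : A} (hx : x ∈ maximalIdeal A ^ i) :
    initial i x hx = 0 ↔ x ∈ maximalIdeal A ^ (i + 1) := by
  rw [← GrPiece.cls_eq_zero_iff hx, initial,
    map_eq_zero_iff _ (DirectSum.of_injective (β := GrPiece (maximalIdeal A)) i)]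

/-- The homogeneous component of degree `i`, as an element of `gr(A)`. -/
noncomputable def component (i : ℕ) (c : Gr A) : Gr A :=
  DirectSum.of (GrPiece (maximalIdeal A)) i (c i)

theorem component_add (i : ℕ) (c d : Gr A) :
    component i (c + d) = component i c + component i d := by
  simp [component]

theorem component_zero (i : ℕ) : component i (0 : Gr A) = 0 := by
  simp [component]

theorem component_of_same (i : ℕ) (c : GrPiece (maximalIdeal A) i) :
    component i (DirectSum.of (GrPiece (maximalIdeal A)) i c) =
      DirectSum.of (GrPiece (maximalIdeal A)) i c := by
  rw [component, DirectSum.of_eq_same]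

theorem component_of_ne {i j : ℕ} (h : i ≠ j) (c : GrPiece (maximalIdeal A) i) :
    component j (DirectSum.of (GrPiece (maximalIdeal A)) i c) = 0 := by
  rw [component, DirectSum.of_eq_of_ne _ _ _ h.symm, map_zero]

theorem exists_component_ne_zero {c : Gr A} (hc : c ≠ 0) : ∃ i, component i c ≠ 0 := by
  by_contra! h
  refine hc (DFinsupp.ext fun i => ?_)
  exact DirectSum.of_injective (β := GrPiece (maximalIdeal A)) i ((h i).trans (map_zero _).symm)

theorem exists_component_eq_initial (i : ℕ) (c : Gr A) :
    ∃ x hx, component i c = initial i x hx := by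
  obtain ⟨x, hx, h⟩ := GrPiece.exists_cls (c i)
  exact ⟨x, hx, by rw [component, h, initial]⟩

@[elab_as_elim]
theorem induction {P : Gr A → Prop} (c : Gr A) (initial : ∀ i x hx, P (initial i x hx))
    (add : ∀ c d, P c → P d → P (c + d)) : P c := by
  induction c using DirectSum.induction_on with
  | zero => rw [← initial_zero 0]; exact initial _ _ _
  | of i c =>
    obtain ⟨x, hx, rfl⟩ := GrPiece.exists_cls c
    exact initial i x hx
  | add c d hc hd => exact add c d hc hd

variable (A) in
/-- The ring homomorphism from `A` to `gr(A)` that sends `x` to its class in degree `0`. -/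
noncomputable def degreeZero : A →+* Gr A where
  toFun x := initial 0 x (by simp)
  map_zero' := initial_zero 0
  map_one' := rfl
  map_add' _ _ := (initial_add _ _).symm
  map_mul' _ _ := (initial_mul (i := 0) (j := 0) _ _).symm

theorem degreeZero_eq_zero_iff {x : A} : degreeZero A x = 0 ↔ x ∈ maximalIdeal A := by
  refine (initial_eq_zero_iff _).trans ?_
  rw [zero_add, pow_one]

theorem isUnit_degreeZero {x : A} (hx : x ∉ maximalIdeal A) : IsUnit (degreeZero A x) :=
  (not_not.1 hx : IsUnit x).map _

/-- By degrees: only the part of c in degree 0 contributes to degree i of the product. -/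
theorem initial_mul_component_zero {i : ℕ} {x : A} (hx : x ∈ maximalIdeal A ^ i) (c : Gr A) :
    component i (initial i x hx * c) = initial i x hx * component 0 c := by
  induction c using Gr.induction with
  | initial j y hy =>
    rw [initial_mul]
    by_cases hj : j = 0
    · subst hj
      rw [initial, initial, initial, component_of_same 0]
      exact (component_of_same i _).trans (initial_mul (j := 0) hx hy).symm
    · rw [initial, initial, initial, component_of_ne (by omega), component_of_ne hj, mul_zero]
  | add c d hc hd => rw [mul_add, component_add, component_add, hc, hd, mul_add]

theorem component_zero_mul (c d : Gr A) :
    component 0 (c * d) = component 0 c * component 0 d := by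
  induction c using Gr.induction with
  | initial j y hy =>
    by_cases hj : j = 0
    · subst hj
      rw [initial_mul_component_zero, initial, component_of_same]
    · rw [initial, component_of_ne hj, zero_mul]
      induction d using Gr.induction with
      | initial k z hz =>
        rw [← initial, initial_mul, initial, component_of_ne (by omega)]
      | add c d hc hd => rw [mul_add, component_add, hc, hd, add_zero]
  | add c c' hc hc' => rw [add_mul, component_add, component_add, hc, hc', add_mul]

theorem component_zero_one : component 0 (1 : Gr A) = 1 :=
  component_of_same 0 _

theorem one_ne_zero' : (1 : Gr A) ≠ 0 := by
  rw [← map_one (degreeZero A), Ne, degreeZero_eq_zero_iff]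
  exact fun h => h isUnit_one

theorem component_zero_ne_zero_of_isUnit {c : Gr A} (hc : IsUnit c) : component 0 c ≠ 0 := by
  intro h
  obtain ⟨d, hd⟩ := hc.exists_right_inv
  have := component_zero_mul c d
  rw [hd, component_zero_one, h, zero_mul] at this
  exact one_ne_zero' this

/-- The degree-0 part of gr(A) is the residue field. -/
theorem isUnit_component_zero {c : Gr A} (hc : component 0 c ≠ 0) : IsUnit (component 0 c) := by
  obtain ⟨x, hx, h⟩ := exists_component_eq_initial 0 c
  rw [h] at hc ⊢
  exact isUnit_degreeZero fun hx => hc (degreeZero_eq_zero_iff.2 hx)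

/-- An ideal generated by elements without component of degree `0` is proper. -/
theorem exists_component_zero_ne_zero_of_span_eq_top {S : Set (Gr A)}
    (h : Ideal.span S = ⊤) : ∃ c ∈ S, component 0 c ≠ 0 := by
  by_contra! hS
  have hle : ∀ c ∈ Ideal.span S, component 0 c = 0 := by
    intro c hc
    induction hc using Submodule.span_induction with
    | mem c hc => exact hS c hc
    | zero => exact component_zero 0
    | add c d _ _ hc hd => rw [component_add, hc, hd, add_zero]
    | smul a c _ hc => rw [smul_eq_mul, component_zero_mul, hc, mul_zero]
  have := hle 1 (h ▸ Submodule.mem_top)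
  rw [component_zero_one] at this
  exact one_ne_zero' this

theorem mem_maximalIdeal_pow {π : A} (hπ : maximalIdeal A = Ideal.span {π}) {i : ℕ} {x : A} :
    x ∈ maximalIdeal A ^ i ↔ ∃ y, x = π ^ i * y := by
  rw [hπ, Ideal.span_singleton_pow, Ideal.mem_span_singleton]
  rfl

theorem pow_mem {π : A} (hπ : maximalIdeal A = Ideal.span {π}) (i : ℕ) (x : A) :
    π ^ i * x ∈ maximalIdeal A ^ i :=
  (mem_maximalIdeal_pow hπ).2 ⟨x, rfl⟩

/-- The class of a generator of `𝔪` in degree `1`. -/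
noncomputable def uniformizer {π : A} (hπ : maximalIdeal A = Ideal.span {π}) : Gr A :=
  initial 1 π (by rw [pow_one, hπ]; exact Ideal.mem_span_singleton_self π)

/-- This dictionary translates homogeneous elements of gr(A) into elements π^i x of A. -/
theorem uniformizer_pow_mul {π : A} (hπ : maximalIdeal A = Ideal.span {π}) (i : ℕ) (x : A) :
    uniformizer hπ ^ i * degreeZero A x = initial i (π ^ i * x) (pow_mem hπ i x) := by
  induction i with
  | zero => rw [pow_zero, one_mul]; exact initial_congr rfl (by simp) _
  | succ i ih =>
    rw [pow_succ', mul_assoc, ih, uniformizer, initial_mul]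
    exact initial_congr (add_comm 1 i) (by ring) _

theorem uniformizer_pow_mul_eq_zero_iff {π : A} (hπ : maximalIdeal A = Ideal.span {π}) {i : ℕ}
    {x : A} : uniformizer hπ ^ i * degreeZero A x = 0 ↔ ∃ y, π ^ i * x = π ^ (i + 1) * y := by
  rw [uniformizer_pow_mul, initial_eq_zero_iff, mem_maximalIdeal_pow hπ]

theorem uniformizer_pow_mul_ne_zero {π : A} (hπ : maximalIdeal A = Ideal.span {π}) {i : ℕ}
    {x : A} (hx : uniformizer hπ ^ i * degreeZero A x ≠ 0) : x ∉ maximalIdeal A :=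
  fun h => hx (by rw [degreeZero_eq_zero_iff.2 h, mul_zero])

theorem mem_maximalIdeal_of_uniformizer_pow_mul_eq_zero {π : A}
    (hπ : maximalIdeal A = Ideal.span {π}) {i : ℕ} {x : A} (hi : uniformizer hπ ^ i ≠ 0)
    (hx : uniformizer hπ ^ i * degreeZero A x = 0) : x ∈ maximalIdeal A := by
  by_contra h
  exact hi ((isUnit_degreeZero h).mul_left_eq_zero.1 hx)

theorem exists_component_eq {π : A} (hπ : maximalIdeal A = Ideal.span {π}) (i : ℕ) (c : Gr A) :
    ∃ x, component i c = uniformizer hπ ^ i * degreeZero A x := by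
  obtain ⟨x, hx, h⟩ := exists_component_eq_initial i c
  obtain ⟨y, rfl⟩ := (mem_maximalIdeal_pow hπ).1 hx
  exact ⟨y, by rw [h, uniformizer_pow_mul]⟩

theorem exists_eq_component_zero_add {π : A} (hπ : maximalIdeal A = Ideal.span {π}) (c : Gr A) :
    ∃ d, c = component 0 c + uniformizer hπ * d := by
  induction c using Gr.induction with
  | initial i x hx =>
    cases i with
    | zero => exact ⟨0, by rw [mul_zero, add_zero, initial, component_of_same]⟩
    | succ i =>
      obtain ⟨y, rfl⟩ := (mem_maximalIdeal_pow hπ).1 hx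
      refine ⟨uniformizer hπ ^ i * degreeZero A y, ?_⟩
      rw [← mul_assoc, ← pow_succ', uniformizer_pow_mul, initial, component_of_ne i.succ_ne_zero,
        zero_add]
  | add c d hc hd =>
    obtain ⟨c', hc'⟩ := hc
    obtain ⟨d', hd'⟩ := hd
    refine ⟨c' + d', ?_⟩
    rw [component_add]
    linear_combination hc' + hd'

theorem component_zero_uniformizer_mul {π : A} (hπ : maximalIdeal A = Ideal.span {π})
    (c : Gr A) : component 0 (uniformizer hπ * c) = 0 := by
  rw [component_zero_mul, uniformizer, initial, component_of_ne one_ne_zero, zero_mul]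

/-- All positive degrees lie in (t), so an element outside (t) is, modulo (t), a non-zero element of
the residue field. -/
theorem isMaximal_span_uniformizer {π : A} (hπ : maximalIdeal A = Ideal.span {π}) :
    (Ideal.span {uniformizer hπ}).IsMaximal := by
  refine Ideal.isMaximal_iff.2 ⟨fun h => ?_, fun J c hJ hc hcJ => ?_⟩
  · obtain ⟨d, hd⟩ := Ideal.mem_span_singleton.1 h
    have := component_zero_uniformizer_mul hπ d
    rw [← hd, component_zero_one] at this
    exact one_ne_zero' this
  · obtain ⟨d, hd⟩ := exists_eq_component_zero_add hπ c
    have htd : uniformizer hπ * d ∈ Ideal.span {uniformizer hπ} :=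
      Ideal.mem_span_singleton.2 (dvd_mul_right _ _)
    have h0 : component 0 c ≠ 0 := by
      intro h
      rw [h, zero_add] at hd
      exact hc (hd ▸ htd)
    have hmem : component 0 c ∈ J := by
      rw [eq_sub_of_add_eq hd.symm]
      exact sub_mem hcJ (hJ htd)
    rw [Ideal.eq_top_of_isUnit_mem J hmem (isUnit_component_zero h0)]
    trivial

/-- If `t ^ i` is a multiple of `t ^ (i + 1)` then it vanishes, by its degree. -/
theorem uniformizer_pow_dvd_iff {π : A} (hπ : maximalIdeal A = Ideal.span {π}) (i : ℕ) :
    uniformizer hπ ^ (i + 1) ∣ uniformizer hπ ^ i ↔ π ^ (i + 1) ∣ π ^ i := by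
  have key : uniformizer hπ ^ i = initial i (π ^ i * 1) (pow_mem hπ i 1) := by
    rw [← uniformizer_pow_mul, map_one, mul_one]
  have hzero : π ^ (i + 1) ∣ π ^ i ↔ uniformizer hπ ^ i = 0 := by
    rw [key, initial_eq_zero_iff, mem_maximalIdeal_pow hπ, mul_one]
    rfl
  rw [hzero]
  refine ⟨?_, fun h => h ▸ dvd_zero _⟩
  rintro ⟨c, hc⟩
  rw [pow_succ, mul_assoc, key] at hc
  -- The left side is homogeneous of degree i, while t^i(tc) has no component in that degree.
  have := congrArg (component i) hc
  rw [initial_mul_component_zero, component_zero_uniformizer_mul, mul_zero, initial,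
    component_of_same, ← initial, ← key] at this
  exact this

/-- Both lengths grow by one at each step until the powers stabilise, which happens at the same i
for t and for π. -/
theorem length_quotient_uniformizer_pow {π : A} (hπ : maximalIdeal A = Ideal.span {π}) (i : ℕ) :
    Module.length (Gr A) (Gr A ⧸ Ideal.span {uniformizer hπ ^ i}) =
      Module.length A (A ⧸ Ideal.span {π ^ i}) :=
  length_quotient_span_pow_eq (isMaximal_span_uniformizer hπ) (hπ ▸ maximalIdeal.isMaximal A)
    (uniformizer_pow_dvd_iff hπ) i

theorem exists_pow_eq_zero [IsArtinianRing A] {π : A} (hπ : maximalIdeal A = Ideal.span {π}) :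
    ∃ N, π ^ N = 0 := by
  obtain ⟨N, hN⟩ := IsArtinianRing.isNilpotent_jacobson_bot (R := A)
  rw [jacobson_eq_maximalIdeal _ bot_ne_top, hπ, Ideal.span_singleton_pow] at hN
  exact ⟨N, Ideal.span_singleton_eq_bot.1 hN⟩

theorem uniformizer_pow_eq_zero {π : A} (hπ : maximalIdeal A = Ideal.span {π}) {i : ℕ}
    (h : π ^ i = 0) : uniformizer hπ ^ i = 0 := by
  have := uniformizer_pow_mul_eq_zero_iff hπ (i := i) (x := 1)
  rw [map_one, mul_one] at this
  exact this.2 ⟨0, by simp [h]⟩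

theorem length_eq_of_isArtinianRing [IsArtinianRing A] {π : A}
    (hπ : maximalIdeal A = Ideal.span {π}) :
    Module.length (Gr A) (Gr A) = Module.length A A := by
  obtain ⟨N, hN⟩ := exists_pow_eq_zero hπ
  have h := length_quotient_uniformizer_pow hπ N
  rw [uniformizer_pow_eq_zero hπ hN, hN] at h
  rwa [(Submodule.quotEquivOfEqBot _ (Ideal.span_singleton_eq_bot.2 rfl)).length_eq,
    (Submodule.quotEquivOfEqBot _ (Ideal.span_singleton_eq_bot.2 rfl)).length_eq] at h

/-- Here t is nilpotent, so c differs from its degree-0 part by a nilpotent element. -/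
theorem isUnit_iff_of_isArtinianRing [IsArtinianRing A] {π : A}
    (hπ : maximalIdeal A = Ideal.span {π}) {c : Gr A} : IsUnit c ↔ component 0 c ≠ 0 := by
  refine ⟨component_zero_ne_zero_of_isUnit, fun h => ?_⟩
  obtain ⟨d, hd⟩ := exists_eq_component_zero_add hπ c
  obtain ⟨N, hN⟩ := exists_pow_eq_zero hπ
  rw [hd]
  refine IsNilpotent.isUnit_add_left_of_commute ⟨N, ?_⟩ (isUnit_component_zero h) (.all _ _)
  rw [mul_pow, uniformizer_pow_eq_zero hπ hN, zero_mul]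

/-- Homogeneity replaces nilpotency of t: over a discrete valuation ring 1 + t is not a unit,
although its degree-0 part is. -/
theorem isUnit_of_iff (i : ℕ) (c : GrPiece (maximalIdeal A) i) :
    IsUnit (DirectSum.of (GrPiece (maximalIdeal A)) i c) ↔
      component 0 (DirectSum.of (GrPiece (maximalIdeal A)) i c) ≠ 0 := by
  refine ⟨component_zero_ne_zero_of_isUnit, fun h => ?_⟩
  by_cases hi : i = 0
  · subst hi
    have := isUnit_component_zero h
    rwa [component_of_same] at this
  · exact absurd (component_of_ne hi c) h

/-- A discrete valuation ring and its associated graded ring both have infinite length. -/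
theorem length_eq_top {π : A} (hπ : maximalIdeal A = Ideal.span {π})
    (h : ∀ i, ¬ π ^ (i + 1) ∣ π ^ i) :
    Module.length A A = ⊤ ∧ Module.length (Gr A) (Gr A) = ⊤ := by
  have key : ∀ {B : Type _} [CommRing B] (t : B), (∀ i, ¬ t ^ (i + 1) ∣ t ^ i) →
      Module.length B B = ⊤ := by
    intro B _ t ht
    by_contra hB
    have hB := isFiniteLength_iff_isNoetherian_isArtinian.1 (Module.length_ne_top_iff.1 hB)
    have : IsArtinian B B := hB.2
    -- Finite length implies the descending chain condition, so the chain of ideals (t^N) would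
    -- stabilise.
    obtain ⟨N, y, hy⟩ := IsArtinian.exists_pow_succ_smul_dvd t (1 : B)
    refine ht N ⟨y, ?_⟩
    simpa using hy.symm
  exact ⟨key π h, key (uniformizer hπ) fun i => by rw [uniformizer_pow_dvd_iff]; exact h i⟩

end Gr

/-! ### Flatness of L/M in terms of powers of π. -/

namespace FreeMod

section MapCoeff

variable {n r : ℕ} {A B : Type*} [CommRing A] [CommRing B]

/-- The map on free modules that applies a ring homomorphism to all coefficients. -/
noncomputable def mapCoeff (φ : A →+* B) (f : FreeMod n r A) : FreeMod n r B :=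
  fun l => MvPolynomial.map φ (f l)

@[simp] theorem coeff_mapCoeff (φ : A →+* B) (X : PowerProduct n r) (f : FreeMod n r A) :
    coeff X (mapCoeff φ f) = φ (coeff X f) := by
  simp [coeff, mapCoeff, MvPolynomial.coeff_map]

theorem mapCoeff_monomial_smul (φ : A →+* B) (s : Fin n →₀ ℕ) (b : A) (f : FreeMod n r A) :
    mapCoeff φ (MvPolynomial.monomial s b • f) =
      MvPolynomial.monomial s (φ b) • mapCoeff φ f := by
  funext l
  simp [mapCoeff, MvPolynomial.map_monomial]

theorem exists_eq_smul_of_forall_coeff {a : A} {f : FreeMod n r A}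
    (h : ∀ X, ∃ y, coeff X f = a * y) : ∃ f', f = a • f' := by
  choose y hy using h
  have hl : ∀ l, (MvPolynomial.C a : MvPolynomial (Fin n) A) ∣ f l := fun l =>
    MvPolynomial.C_dvd_iff_dvd_coeff a (f l) |>.2 fun s => ⟨y ⟨s, l⟩, hy ⟨s, l⟩⟩
  choose g hg using hl
  refine ⟨g, funext fun l => ?_⟩
  rw [hg l, Pi.smul_apply, MvPolynomial.C_mul']

end MapCoeff

variable {A : Type*} [CommRing A] {n r : ℕ}

theorem smul_mem_of_mem {M : Submodule (MvPolynomial (Fin n) A) (FreeMod n r A)} (a : A)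
    {f : FreeMod n r A} (hf : f ∈ M) : a • f ∈ M := by
  rw [← C_smul_eq]
  exact M.smul_mem _ hf

/-- Artin–Rees is applied over R, where L is finitely generated; this translates its ideal powers
into scalars from A. -/
theorem span_C_pow_smul (a : A) (i : ℕ)
    (N : Submodule (MvPolynomial (Fin n) A) (FreeMod n r A)) (f : FreeMod n r A) :
    f ∈ (Ideal.span {(MvPolynomial.C a : MvPolynomial (Fin n) A)} ^ i • N) ↔
      ∃ g ∈ N, f = a ^ i • g := by
  rw [Ideal.span_singleton_pow, Submodule.ideal_span_singleton_smul,
    Submodule.mem_smul_pointwise_iff_exists]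
  refine exists_congr fun g => and_congr_right fun _ => ?_
  rw [← map_pow, C_smul_eq, eq_comm]

/-- By the Artin–Rees lemma, the equalities `M ∩ π ^ i L = π ^ i M` hold as soon as they hold
modulo `π ^ (i + 1) L`. -/
theorem exists_smul_eq_of_artinRees [IsNoetherianRing A] {π : A}
    {M : Submodule (MvPolynomial (Fin n) A) (FreeMod n r A)}
    (h : ∀ (i : ℕ) (f : FreeMod n r A), π ^ i • f ∈ M →
      ∃ m ∈ M, ∃ f', π ^ i • f = π ^ i • m + π ^ (i + 1) • f')
    (i : ℕ) (f : FreeMod n r A) (hf : π ^ i • f ∈ M) : ∃ m ∈ M, π ^ i • f = π ^ i • m := by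
  have key : ∀ k : ℕ, ∃ m ∈ M, ∃ f', π ^ i • f = π ^ i • m + π ^ (i + k) • f' := by
    intro k
    induction k with
    | zero => exact ⟨0, zero_mem _, f, by simp⟩
    | succ k ih =>
      obtain ⟨m, hm, f', hf'⟩ := ih
      have hmem : π ^ (i + k) • f' ∈ M := by
        rw [← sub_eq_of_eq_add' hf']
        exact sub_mem hf (smul_mem_of_mem _ hm)
      obtain ⟨m', hm', f'', hf''⟩ := h _ _ hmem
      refine ⟨m + π ^ k • m', add_mem hm (smul_mem_of_mem _ hm'), f'', ?_⟩
      rw [hf', hf'', smul_add, smul_smul, ← pow_add, add_assoc, add_assoc]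
  -- For the Artin–Rees constant k, M ∩ π^(i+k) L ⊆ π^i M, which absorbs the error left after k
  -- rounds.
  obtain ⟨k, hk⟩ := Ideal.exists_pow_inf_eq_pow_smul
    (Ideal.span {(MvPolynomial.C π : MvPolynomial (Fin n) A)}) M
  obtain ⟨m, hm, f', hf'⟩ := key k
  have hmem : π ^ (i + k) • f' ∈ M := by
    rw [← sub_eq_of_eq_add' hf']
    exact sub_mem hf (smul_mem_of_mem _ hm)
  have hmem' := hk (i + k) (Nat.le_add_left k i) ▸ Submodule.mem_inf.2
    ⟨(span_C_pow_smul π (i + k) ⊤ _).2 ⟨f', Submodule.mem_top, rfl⟩, hmem⟩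
  rw [Nat.add_sub_cancel] at hmem'
  obtain ⟨m', hm', h'⟩ := (span_C_pow_smul π i _ _).1 hmem'
  refine ⟨m + m', add_mem hm hm'.2, ?_⟩
  rw [hf', h', smul_add]

variable [IsLocalRing A]

theorem flat_quotient_iff [IsNoetherianRing A] {π : A} (hπ : maximalIdeal A = Ideal.span {π})
    (M : Submodule (MvPolynomial (Fin n) A) (FreeMod n r A)) :
    Module.Flat A (FreeMod n r A ⧸ M) ↔ ∀ (i : ℕ) (f : FreeMod n r A), π ^ i • f ∈ M →
      ∃ m ∈ M, π ^ i • f = π ^ i • m := by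
  have := isPrincipalIdealRing_of_maximalIdeal_eq hπ
  have hker : ∀ f, (M.mkQ.restrictScalars A) f = 0 ↔ f ∈ M := fun f => by simp
  rw [Module.Flat.iff_forall_smul_mem_ker (M.mkQ.restrictScalars A) M.mkQ_surjective]
  simp only [hker]
  refine ⟨fun h i f => h (π ^ i) f, fun h x f hf => ?_⟩
  rcases eq_zero_or_eq_unit_mul_pow hπ x with rfl | ⟨u, i, hu, rfl⟩
  · exact ⟨0, zero_mem _, by simp⟩
  · obtain ⟨v, hv⟩ := hu.exists_left_inv
    have hf' : π ^ i • f ∈ M := by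
      have := smul_mem_of_mem v hf
      rwa [smul_smul, ← mul_assoc, hv, one_mul] at this
    obtain ⟨m, hm, hfm⟩ := h i f hf'
    exact ⟨m, hm, by rw [mul_smul, hfm, mul_smul]⟩

/-! ### The graded module gr(M) and its homogeneous components. -/

section Gr

/-- The ring structure of `gr(A)`, as a shortcut for instance search. -/
noncomputable local instance instCommRingGr : CommRing (Gr A) := inferInstance

open Gr

/-- An element of M ∩ 𝔪^i L is π^i f, and its class is t^i times the reduction of f modulo 𝔪. -/
theorem mem_grPart_iff {π : A} (hπ : maximalIdeal A = Ideal.span {π})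
    {M : Submodule (MvPolynomial (Fin n) A) (FreeMod n r A)} {i : ℕ} {F : FreeMod n r (Gr A)} :
    F ∈ grPart M i ↔
      ∃ f, π ^ i • f ∈ M ∧ F = uniformizer hπ ^ i • mapCoeff (degreeZero A) f := by
  constructor
  · rintro ⟨f, hf, -, h⟩
    obtain ⟨f', rfl⟩ := exists_eq_smul_of_forall_coeff fun X =>
      (mem_maximalIdeal_pow hπ).1 (h X).choose
    refine ⟨f', hf, ext_coeff fun X => ?_⟩
    rw [coeff_smul X (uniformizer hπ ^ i), coeff_mapCoeff, uniformizer_pow_mul]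
    exact (h X).choose_spec.trans (initial_congr rfl (coeff_smul X _ f') _)
  · rintro ⟨f, hf, rfl⟩
    refine ⟨π ^ i • f, hf, Submodule.smul_mem_smul (by simpa using pow_mem hπ i 1)
      Submodule.mem_top, fun X => ⟨by rw [coeff_smul]; exact pow_mem hπ i _, ?_⟩⟩
    rw [coeff_smul, coeff_mapCoeff, uniformizer_pow_mul]
    exact initial_congr rfl (coeff_smul X _ f).symm _

/-- The homogeneous components of an element of `gr(M)` belong to `gr(M)`. -/
theorem exists_component_of_mem_grSubmodule {π : A} (hπ : maximalIdeal A = Ideal.span {π})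
    {M : Submodule (MvPolynomial (Fin n) A) (FreeMod n r A)} {F : FreeMod n r (Gr A)}
    (hF : F ∈ grSubmodule M) (i : ℕ) :
    ∃ f, π ^ i • f ∈ M ∧
      ∀ X, component i (coeff X F) = uniformizer hπ ^ i * degreeZero A (coeff X f) := by
  -- As an additive group gr(M) is generated by products of scalars with homogeneous elements; the
  -- scalars are then split into monomials with homogeneous coefficients.
  induction hF using Submodule.closure_induction with
  | zero => exact ⟨0, by simp, fun X => by simp [component_zero]⟩
  | add F F' _ _ h h' =>
    obtain ⟨f, hf, hF⟩ := h
    obtain ⟨f', hf', hF'⟩ := h'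
    refine ⟨f + f', by rw [smul_add]; exact add_mem hf hf', fun X => ?_⟩
    rw [coeff_add, component_add, hF, hF', coeff_add, map_add, mul_add]
  | smul_mem p F hF =>
    obtain ⟨j, hF⟩ := Set.mem_iUnion.1 hF
    obtain ⟨f, hf, rfl⟩ := (mem_grPart_iff hπ).1 hF
    induction p using MvPolynomial.induction_on' with
    | monomial s b =>
      induction b using Gr.induction with
      | initial k y hy =>
        obtain ⟨z, rfl⟩ := (mem_maximalIdeal_pow hπ).1 hy
        have hmem : π ^ (j + k) • MvPolynomial.monomial s z • f ∈ M := by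
          have := smul_mem_of_mem (π ^ k) (M.smul_mem (MvPolynomial.monomial s z) hf)
          rwa [smul_comm (MvPolynomial.monomial s z), smul_smul, ← pow_add, add_comm k] at this
        have heq : MvPolynomial.monomial s (initial k (π ^ k * z) hy) •
            uniformizer hπ ^ j • mapCoeff (degreeZero A) f = uniformizer hπ ^ (j + k) •
              mapCoeff (degreeZero A) (MvPolynomial.monomial s z • f) := by
          rw [← uniformizer_pow_mul hπ, mapCoeff_monomial_smul, ← MvPolynomial.C_mul_monomial,
            mul_smul, C_smul_eq, smul_comm (MvPolynomial.monomial s _), smul_smul, ← pow_add,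
            add_comm]
        rw [heq]
        by_cases hi : i = j + k
        · subst hi
          refine ⟨_, hmem, fun X => ?_⟩
          rw [coeff_smul, coeff_mapCoeff, uniformizer_pow_mul]
          exact component_of_same _ _
        · refine ⟨0, by simp, fun X => ?_⟩
          rw [coeff_smul, coeff_mapCoeff, uniformizer_pow_mul, coeff_zero, map_zero, mul_zero]
          exact component_of_ne (Ne.symm hi) _
      | add b c hb hc =>
        obtain ⟨f₁, hf₁, h₁⟩ := hb
        obtain ⟨f₂, hf₂, h₂⟩ := hc
        refine ⟨f₁ + f₂, by rw [smul_add]; exact add_mem hf₁ hf₂, fun X => ?_⟩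
        rw [map_add, add_smul, coeff_add, component_add, h₁, h₂, coeff_add, map_add, mul_add]
    | add p q hp hq =>
      obtain ⟨f₁, hf₁, h₁⟩ := hp
      obtain ⟨f₂, hf₂, h₂⟩ := hq
      refine ⟨f₁ + f₂, by rw [smul_add]; exact add_mem hf₁ hf₂, fun X => ?_⟩
      rw [add_smul, coeff_add, component_add, h₁, h₂, coeff_add, map_add, mul_add]

theorem smul_mapCoeff_mem_grSubmodule {π : A} (hπ : maximalIdeal A = Ideal.span {π})
    {M : Submodule (MvPolynomial (Fin n) A) (FreeMod n r A)} {i : ℕ} {f : FreeMod n r A}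
    (hf : π ^ i • f ∈ M) :
    uniformizer hπ ^ i • mapCoeff (degreeZero A) f ∈ grSubmodule M :=
  Submodule.subset_span (Set.mem_iUnion.2 ⟨i, (mem_grPart_iff hπ).2 ⟨f, hf, rfl⟩⟩)

variable [LinearOrder (PowerProduct n r)]

/-! ### Flatness and unit leading coefficients. -/

/-- The leading power product of every element of `G` is divisible by that of an element of `G`
whose leading coefficient is a unit. -/
def HasUnitDivisors (G : Finset (FreeMod n r (Gr A))) : Prop :=
  ∀ g ∈ G, ∀ X : PowerProduct n r, lp g = X → ∃ g' ∈ G, IsUnit (lc g') ∧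
    ∃ X' : PowerProduct n r, lp g' = X' ∧ X'.Divides X

theorem exists_unit_of_leadIdeal_eq_top {G : Finset (FreeMod n r (Gr A))}
    (hunit : ∀ g ∈ G, IsUnit (lc g) ↔ component 0 (lc g) ≠ 0) {X : PowerProduct n r}
    (h : leadIdeal G X = ⊤) :
    ∃ g' ∈ G, IsUnit (lc g') ∧ ∃ X' : PowerProduct n r, lp g' = X' ∧ X'.Divides X := by
  obtain ⟨c, ⟨g, hg, Y, hY, hYX, rfl⟩, hc⟩ := exists_component_zero_ne_zero_of_span_eq_top h
  exact ⟨g, hg, (hunit g hg).2 hc, Y, hY, hYX⟩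

theorem hasUnitDivisors_of_flat [IsNoetherianRing A] {π : A}
    (hπ : maximalIdeal A = Ideal.span {π})
    {M : Submodule (MvPolynomial (Fin n) A) (FreeMod n r A)} {G : Finset (FreeMod n r (Gr A))}
    (hG : IsGroebnerBasis (grSubmodule M) G)
    (hunit : ∀ g ∈ G, IsUnit (lc g) ↔ component 0 (lc g) ≠ 0)
    (hflat : Module.Flat A (FreeMod n r A ⧸ M)) : HasUnitDivisors G := by
  intro g hg X hX
  refine exists_unit_of_leadIdeal_eq_top hunit ?_
  -- Over an Artinian ring g need not be homogeneous; any degree in which its leading coefficient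
  -- survives will do.
  obtain ⟨i, hi⟩ := exists_component_ne_zero (coeff_ne_zero_of_lp_eq hX)
  obtain ⟨f, hf, hgf⟩ := exists_component_of_mem_grSubmodule hπ (hG.mem g hg) i
  obtain ⟨m, hm, hfm⟩ := (flat_quotient_iff hπ M).1 hflat i f hf
  have hgm : ∀ Y, component i (coeff Y g) = uniformizer hπ ^ i * degreeZero A (coeff Y m) := by
    intro Y
    rw [hgf, uniformizer_pow_mul, uniformizer_pow_mul]
    refine initial_congr rfl ?_ _
    rw [← coeff_smul, ← coeff_smul, hfm]
  rw [hgm] at hi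
  have hXm := uniformizer_pow_mul_ne_zero hπ hi
  have hlp : lp (mapCoeff (degreeZero A) m) = X := by
    refine lp_eq_iff.2 ⟨?_, fun Y hY => ?_⟩
    · rw [coeff_mapCoeff, Ne, degreeZero_eq_zero_iff]
      exact hXm
    · rw [coeff_mapCoeff, degreeZero_eq_zero_iff]
      -- Since t^i ≠ 0, the vanishing of t^i times the class of a coefficient of m forces that
      -- coefficient into 𝔪.
      refine mem_maximalIdeal_of_uniformizer_pow_mul_eq_zero hπ (i := i)
        (fun h0 => hi (by rw [h0, zero_mul])) ?_
      rw [← hgm, (lp_eq_iff.1 hX).2 Y hY, component_zero]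
  have hmem : mapCoeff (degreeZero A) m ∈ grSubmodule M := by
    have := smul_mapCoeff_mem_grSubmodule hπ (M := M) (i := 0) (f := m) (by simpa using hm)
    rwa [pow_zero, one_smul] at this
  have := hG.coeff_mem_leadIdeal hmem hlp
  rw [coeff_mapCoeff] at this
  exact Ideal.eq_top_of_isUnit_mem _ this (isUnit_degreeZero hXm)

/-- If the leading power products of `gr(M)` are divisible by those of elements with invertible
leading coefficient, then `M ∩ π ^ i L ⊆ π ^ i M + π ^ (i + 1) L`. -/
theorem exists_smul_eq_add (hord : IsTermOrder n r) {π : A}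
    (hπ : maximalIdeal A = Ideal.span {π})
    {M : Submodule (MvPolynomial (Fin n) A) (FreeMod n r A)} {G : Finset (FreeMod n r (Gr A))}
    (hG : IsGroebnerBasis (grSubmodule M) G) (hdiv : HasUnitDivisors G)
    (i : ℕ) (f : FreeMod n r A) (hf : π ^ i • f ∈ M) :
    ∃ m ∈ M, ∃ f', π ^ i • f = π ^ i • m + π ^ (i + 1) • f' := by
  have := PowerProduct.wellFoundedLT hord
  -- Division algorithm: the leading power product of the class of π^i f decreases, and the term
  -- order is a well-order.
  induction hd : lp (uniformizer hπ ^ i • mapCoeff (degreeZero A) f) using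
    WellFoundedLT.induction generalizing f with
  | ind d ih =>
  subst hd
  by_cases h0 : uniformizer hπ ^ i • mapCoeff (degreeZero A) f = 0
  -- A zero class means that π^i f already lies in π^(i+1) L.
  · obtain ⟨f', hf'⟩ := exists_eq_smul_of_forall_coeff (a := π ^ (i + 1)) (f := π ^ i • f) <| by
      intro X
      rw [coeff_smul, ← uniformizer_pow_mul_eq_zero_iff hπ, ← coeff_mapCoeff, ← coeff_smul, h0,
        coeff_zero]
    exact ⟨0, zero_mem _, f', by rw [hf', smul_zero, zero_add]⟩
  · obtain ⟨X, hX⟩ := exists_lp_eq h0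
    have hlead := hG.coeff_mem_leadIdeal (smul_mapCoeff_mem_grSubmodule hπ hf) hX
    have hexists : ∃ g ∈ G, ∃ Y : PowerProduct n r, lp g = Y ∧ Y.Divides X := by
      by_contra! hne
      have hbot : leadIdeal G X = ⊥ := by
        refine Ideal.span_eq_bot.2 ?_
        rintro c ⟨g, hg, Y, hY, hYX, -⟩
        exact absurd hYX (hne g hg Y hY)
      rw [hbot, Ideal.mem_bot] at hlead
      exact coeff_ne_zero_of_lp_eq hX hlead
    obtain ⟨g, hg, Y, hY, hYX⟩ := hexists
    obtain ⟨g', hg', hu, X', hX', hdvd⟩ := hdiv g hg Y hY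
    obtain ⟨s, rfl⟩ := hdvd.trans hYX
    -- The degree-0 component of g' lifts to m in M itself. It keeps the leading power product X',
    -- because `lc g'` is a unit.
    obtain ⟨m, hm, hgm⟩ := exists_component_of_mem_grSubmodule hπ (hG.mem g' hg') 0
    simp only [pow_zero, one_smul, one_mul] at hm hgm
    have hXm : coeff X' m ∉ maximalIdeal A := by
      rw [← degreeZero_eq_zero_iff, ← hgm, ← lc_of_lp_eq hX']
      exact component_zero_ne_zero_of_isUnit hu
    have hZm : ∀ Z, X' < Z → coeff Z m ∈ maximalIdeal A := by
      intro Z hZ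
      rw [← degreeZero_eq_zero_iff, ← hgm, (lp_eq_iff.1 hX').2 Z hZ, component_zero]
    obtain ⟨v, hv⟩ := (not_not.1 hXm : IsUnit (coeff X' m)).exists_left_inv
    -- With v inverse to the coefficient of m at X', m₁ has exactly the coefficient of f at sX';
    -- above sX' its coefficients lie in 𝔪.
    set m₁ : FreeMod n r A := MvPolynomial.monomial s (coeff (X'.shift s) f * v) • m with hm₁
    have hm₁M : m₁ ∈ M := M.smul_mem _ hm
    have hlt : lp (uniformizer hπ ^ i • mapCoeff (degreeZero A) (f - m₁)) <
        lp (uniformizer hπ ^ i • mapCoeff (degreeZero A) f) := by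
      rw [hX]
      refine lp_lt_iff.2 fun Z hZ => ?_
      rw [coeff_smul, coeff_mapCoeff, coeff_sub]
      rcases hZ.eq_or_lt with rfl | hlt
      · rw [hm₁, coeff_monomial_smul_shift, mul_assoc, hv, mul_one, sub_self, map_zero, mul_zero]
      · have hZf := (lp_eq_iff.1 hX).2 Z hlt
        rw [coeff_smul, coeff_mapCoeff] at hZf
        rw [map_sub, mul_sub, hZf, zero_sub, neg_eq_zero]
        have hmem : coeff Z m₁ ∈ maximalIdeal A := by
          by_cases hs : s ≤ Z.exp
          · obtain ⟨W, rfl⟩ := PowerProduct.exists_eq_shift hs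
            rw [hm₁, coeff_monomial_smul_shift]
            refine Ideal.mul_mem_left _ _ (hZm W ?_)
            by_contra hle
            rcases (not_lt.1 hle).eq_or_lt with rfl | h
            · exact lt_irrefl _ hlt
            · exact lt_asymm hlt (hord.shift_lt_shift _ _ s h)
          · rw [hm₁, coeff_monomial_smul_of_not_le _ hs]
            exact zero_mem _
        rw [degreeZero_eq_zero_iff.2 hmem, mul_zero]
    obtain ⟨m₂, hm₂, f', hf'⟩ := ih _ hlt (f - m₁)
      (by rw [smul_sub]; exact sub_mem hf (smul_mem_of_mem _ hm₁M)) rfl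
    refine ⟨m₁ + m₂, add_mem hm₁M hm₂, f', ?_⟩
    rw [smul_add, add_assoc, ← hf', smul_sub, add_sub_cancel]

theorem flat_of_hasUnitDivisors (hord : IsTermOrder n r) [IsNoetherianRing A] {π : A}
    (hπ : maximalIdeal A = Ideal.span {π})
    {M : Submodule (MvPolynomial (Fin n) A) (FreeMod n r A)} {G : Finset (FreeMod n r (Gr A))}
    (hG : IsGroebnerBasis (grSubmodule M) G) (hdiv : HasUnitDivisors G) :
    Module.Flat A (FreeMod n r A ⧸ M) :=
  (flat_quotient_iff hπ M).2 (exists_smul_eq_of_artinRees (exists_smul_eq_add hord hπ hG hdiv))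

/-! ### Lengths, minimality and the final equivalences. -/

theorem mInv_eq_zero_iff {G : Finset (FreeMod n r (Gr A))} {X : PowerProduct n r} :
    mInv G X = 0 ↔ leadIdeal G X = ⊤ := by
  rw [mInv, Module.length_eq_zero_iff]
  exact Submodule.Quotient.subsingleton_iff

theorem mInv_of_leadIdeal_eq_bot {G : Finset (FreeMod n r (Gr A))} {X : PowerProduct n r}
    (h : leadIdeal G X = ⊥) : mInv G X = Module.length (Gr A) (Gr A) :=
  (Submodule.quotEquivOfEqBot _ h).length_eq

theorem mInv_eq_zero_or_of_hasUnitDivisors {G : Finset (FreeMod n r (Gr A))}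
    (hdiv : HasUnitDivisors G) (X : PowerProduct n r) :
    mInv G X = 0 ∨ mInv G X = Module.length (Gr A) (Gr A) := by
  by_cases h : ∃ g ∈ G, ∃ Y : PowerProduct n r, lp g = Y ∧ Y.Divides X
  · left
    obtain ⟨g, hg, Y, hY, hYX⟩ := h
    obtain ⟨g', hg', hu, X', hX', hdvd⟩ := hdiv g hg Y hY
    rw [mInv_eq_zero_iff]
    exact Ideal.eq_top_of_isUnit_mem _ (lc_mem_leadIdeal hg' hX' (hdvd.trans hYX)) hu
  · right
    refine mInv_of_leadIdeal_eq_bot (Ideal.span_eq_bot.2 ?_)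
    rintro c ⟨g, hg, Y, hY, hYX, -⟩
    exact absurd ⟨g, hg, Y, hY, hYX⟩ h

/-- At X = X_j the ideal contains c_j, so `ha` excludes length a and only the unit ideal remains. -/
theorem hasUnitDivisors_of_mInv {G : Finset (FreeMod n r (Gr A))}
    (hunit : ∀ g ∈ G, IsUnit (lc g) ↔ component 0 (lc g) ≠ 0) {a : ℕ∞}
    (ha : ∀ g ∈ G, ∀ J : Ideal (Gr A), lc g ∈ J → Module.length (Gr A) (Gr A ⧸ J) ≠ a)
    (h : ∀ X, mInv G X = 0 ∨ mInv G X = a) : HasUnitDivisors G := by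
  intro g hg X hX
  refine exists_unit_of_leadIdeal_eq_top hunit (mInv_eq_zero_iff.1 ((h X).resolve_right ?_))
  exact ha g hg _ (lc_mem_leadIdeal hg hX (PowerProduct.Divides.refl X))

/-- If `lc g` is not a unit, the divisor with unit leading coefficient is a different element of G,
and it strictly reduces g. -/
theorem hasUnitDivisors_iff_of_isMinimal (hord : IsTermOrder n r) {G : Finset (FreeMod n r (Gr A))}
    (h0 : ∀ g ∈ G, g ≠ 0) (hmin : IsMinimal G) :
    HasUnitDivisors G ↔ ∀ g ∈ G, IsUnit (lc g) := by
  classical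
  constructor
  · intro hdiv g hg
    by_contra hu
    obtain ⟨X, hX⟩ := exists_lp_eq (h0 g hg)
    obtain ⟨g', hg', hu', X', hX', hdvd⟩ := hdiv g hg X hX
    have hne : g' ≠ g := by
      rintro rfl
      exact hu hu'
    refine hmin g hg (exists_reducesStrictly hord (p := g') ?_ hX hX' hdvd hu')
    simp [hne, hg']
  · intro h g hg X hX
    exact ⟨g, hg, h g hg, X, hX, PowerProduct.Divides.refl X⟩

/-- Dividing a module of finite length by a non-zero submodule strictly lowers the length. -/
theorem length_quotient_ne_of_isArtinianRing [IsArtinianRing A] {π : A}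
    (hπ : maximalIdeal A = Ideal.span {π}) {c : Gr A} (hc : c ≠ 0) {J : Ideal (Gr A)}
    (hcJ : c ∈ J) : Module.length (Gr A) (Gr A ⧸ J) ≠ Module.length A A := by
  have hfin : Module.length (Gr A) (Gr A) ≠ ⊤ := by
    rw [length_eq_of_isArtinianRing hπ]
    exact Module.length_ne_top
  obtain ⟨_, _⟩ := isFiniteLength_iff_isNoetherian_isArtinian.1 (Module.length_ne_top_iff.1 hfin)
  rw [← length_eq_of_isArtinianRing hπ]
  exact (Submodule.length_quotient_lt J fun h => hc ((Ideal.mem_bot).1 (h ▸ hcJ))).ne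

/-- A non-zero homogeneous element is a unit times t^i, so J contains t^i. -/
theorem length_quotient_ne_top_of_mem {π : A} (hπ : maximalIdeal A = Ideal.span {π}) {i : ℕ}
    {c : GrPiece (maximalIdeal A) i} (hc : DirectSum.of (GrPiece (maximalIdeal A)) i c ≠ 0)
    {J : Ideal (Gr A)} (hcJ : DirectSum.of (GrPiece (maximalIdeal A)) i c ∈ J) :
    Module.length (Gr A) (Gr A ⧸ J) ≠ ⊤ := by
  obtain ⟨x, hx⟩ := exists_component_eq hπ i (DirectSum.of (GrPiece (maximalIdeal A)) i c)
  rw [component_of_same] at hx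
  rw [hx] at hc hcJ
  have hu := isUnit_degreeZero (uniformizer_pow_mul_ne_zero hπ hc)
  have hle : Ideal.span {uniformizer hπ ^ i} ≤ J :=
    (Ideal.span_singleton_le_iff_mem J).2 ((Ideal.mul_unit_mem_iff_mem J hu).1 hcJ)
  exact ne_top_of_le_ne_top
    (length_quotient_span_pow_ne_top (isMaximal_span_uniformizer hπ) i)
    (Module.length_le_of_surjective (Submodule.factor hle) (Submodule.factor_surjective hle))

/-- The equivalence of the three conditions, given the properties of the leading coefficients that
hold both over an Artinian ring and for homogeneous elements over a discrete valuation ring. -/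
theorem tfae_flat (hord : IsTermOrder n r) [IsNoetherianRing A] {π : A}
    (hπ : maximalIdeal A = Ideal.span {π})
    {M : Submodule (MvPolynomial (Fin n) A) (FreeMod n r A)} {G : Finset (FreeMod n r (Gr A))}
    (hG : IsGroebnerBasis (grSubmodule M) G)
    (hunit : ∀ g ∈ G, IsUnit (lc g) ↔ component 0 (lc g) ≠ 0)
    (hlen : Module.length (Gr A) (Gr A) = Module.length A A)
    (hne : ∀ g ∈ G, ∀ J : Ideal (Gr A), lc g ∈ J →
      Module.length (Gr A) (Gr A ⧸ J) ≠ Module.length A A) :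
    List.TFAE [Module.Flat A (FreeMod n r A ⧸ M),
      ∀ X : PowerProduct n r, mInv G X = 0 ∨ mInv G X = Module.length A A,
      HasUnitDivisors G] := by
  tfae_have 1 → 3 := hasUnitDivisors_of_flat hπ hG hunit
  tfae_have 3 → 1 := flat_of_hasUnitDivisors hord hπ hG
  tfae_have 2 → 3 := hasUnitDivisors_of_mInv hunit hne
  tfae_have 3 → 2 := by
    rw [← hlen]
    exact mInv_eq_zero_or_of_hasUnitDivisors
  tfae_finish

theorem tfae_flat_of_isTDVR (hA : IsTDVR A) (hord : IsTermOrder n r)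
    {M : Submodule (MvPolynomial (Fin n) A) (FreeMod n r A)} {G : Finset (FreeMod n r (Gr A))}
    (hG : IsGroebnerBasis (grSubmodule M) G)
    (hhom : IsArtinianRing A ∨ ∀ g ∈ G, ∃ i, IsHomogeneousOfDegree i g) :
    List.TFAE [Module.Flat A (FreeMod n r A ⧸ M),
      ∀ X : PowerProduct n r, mInv G X = 0 ∨ mInv G X = Module.length A A,
      HasUnitDivisors G] := by
  -- Splitting on Artinian or not, rather than on the two cases of `IsTDVR`, makes `hhom` supply
  -- homogeneity exactly where t is not nilpotent.
  by_cases hart : IsArtinianRing A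
  · obtain ⟨π, hπ⟩ : (maximalIdeal A).IsPrincipal := by
      rcases hA with ⟨-, h⟩ | ⟨_, _⟩
      · exact h
      · exact IsPrincipalIdealRing.principal _
    exact tfae_flat hord hπ hG (fun _ _ => isUnit_iff_of_isArtinianRing hπ)
      (length_eq_of_isArtinianRing hπ)
      fun g hg _ => length_quotient_ne_of_isArtinianRing hπ (lc_ne_zero (hG.ne_zero g hg))
  · obtain ⟨_, _⟩ := hA.resolve_left fun h => hart h.1
    obtain ⟨π, hπ⟩ := (IsPrincipalIdealRing.principal (maximalIdeal A)).principal
    have hπ0 : π ≠ 0 := by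
      rintro rfl
      exact IsDiscreteValuationRing.not_a_field A (by simpa using hπ)
    have hπu : ¬ IsUnit π := by
      have : π ∈ maximalIdeal A := hπ ▸ Submodule.mem_span_singleton_self π
      exact this
    have hdvd : ∀ i, ¬ π ^ (i + 1) ∣ π ^ i := fun i h => by
      have := (pow_dvd_pow_iff hπ0 hπu).1 h
      omega
    have hlen := length_eq_top hπ hdvd
    have hlc : ∀ g ∈ G, ∃ i c, lc g = DirectSum.of (GrPiece (maximalIdeal A)) i c := by
      intro g hg
      obtain ⟨i, hi⟩ := hhom.resolve_left hart g hg
      obtain ⟨X, hX⟩ := exists_lp_eq (hG.ne_zero g hg)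
      obtain ⟨c, hc⟩ := hi X
      exact ⟨i, c, by rw [lc_of_lp_eq hX, hc]⟩
    refine tfae_flat hord hπ hG (fun g hg => ?_) (hlen.2.trans hlen.1.symm) fun g hg J hJ => ?_
    · obtain ⟨i, c, hc⟩ := hlc g hg
      rw [hc]
      exact isUnit_of_iff i c
    · obtain ⟨i, c, hc⟩ := hlc g hg
      have h0 := lc_ne_zero (hG.ne_zero g hg)
      rw [hc] at h0 hJ
      rw [hlen.1]
      exact length_quotient_ne_top_of_mem hπ h0 hJ

end Gr

end FreeMod

theorem mainTheorem1 {A : Type*} [CommRing A] [IsLocalRing A] (hA : IsTDVR A) (n r : ℕ)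
    [LinearOrder (PowerProduct n r)] (hord : IsTermOrder n r)
    (M : Submodule (MvPolynomial (Fin n) A) (FreeMod n r A))
    (G : Finset (FreeMod n r (Gr A)))
    (hG : FreeMod.IsGroebnerBasis (grSubmodule M) G)
    (hhom : IsArtinianRing A ∨ ∀ g ∈ G, ∃ i, FreeMod.IsHomogeneousOfDegree i g) :
    List.TFAE
      [Module.Flat A (FreeMod n r A ⧸ M),
        ∀ X : PowerProduct n r,
          FreeMod.mInv G X = 0 ∨ FreeMod.mInv G X = Module.length A A,
        ∀ g ∈ G, ∀ X : PowerProduct n r, FreeMod.lp g = X →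
          ∃ g' ∈ G, IsUnit (FreeMod.lc g') ∧
            ∃ X' : PowerProduct n r, FreeMod.lp g' = X' ∧ X'.Divides X] ∧
    (FreeMod.IsMinimal G →
      (Module.Flat A (FreeMod n r A ⧸ M) ↔ ∀ g ∈ G, IsUnit (FreeMod.lc g))) := by
  have h := FreeMod.tfae_flat_of_isTDVR hA hord hG hhom
  exact ⟨h, fun hmin =>
    (h.out 0 2).trans (FreeMod.hasUnitDivisors_iff_of_isMinimal hord hG.ne_zero hmin)⟩
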